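/- Let $n\ge 1$ be an integer and $n<p<\infty$. Let $\mathbb H^n$ be hyperbolic space in the Poincaré half-space model $\mathbb R^n_+=\{z\in\mathbb R^n : z_n>0\}$, with distance $d(x,y)=2\sinh^{-1}\!\Big(\frac{|x-y|}{2\sqrt{x_ny_n}}\Big)$ and volume $\frac{dz}{z_n^{n}}$, and let $\dot W^{1,p}(\mathbb H^n)$ be the set of functions $u\in W^{1,1}_{\mathrm{loc}}(\mathbb R^n_+)$, real-valued, whose weak derivative $Du$ satisfies $$\|Du\|_{L^p(\mathbb H^n)}=\Big(\int_{\mathbb H^n}|Du|^p\Big)^{1/p}<\infty ,\qquad \int_{\mathbb H^n}|Du|^p=\int_{\mathbb R^n_+}\big(z_n|Du(z)|\big)^p\,\frac{dz}{z_n^n},$$ where $|Du(z)|$ in the last integral is the Euclidean norm. 1. There exists a constant $C>0$, depending only on $n$ and $p$, such that for every $u\in\dot W^{1,p}(\mathbb H^n)$ and for almost every $(x,y)\in\mathbb H^n\times\mathbb H^n$, $$|u(x)-u(y)|\le C\max\big(d(x,y)^{1-\frac np},\,d(x,y)^{1-\frac1p}\big)\,\|Du\|_{L^p(\mathbb H^n)}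 .$$ 2. There exists a constant $c>0$, depending only on $n$ and $p$, such that, whenever a function $\theta:[0,\infty)\to[0,\infty)$ satisfies, for every $u\in\dot W^{1,p}(\mathbb H^n)$ and for almost every $(x,y)\in\mathbb H^n\times\mathbb H^n$, $$|u(x)-u(y)|\le\theta(d(x,y))\,\|Du\|_{L^p(\mathbb H^n)},$$ then $$\theta(t)\ge c\,\max\big(t^{1-\frac np},\,t^{1-\frac1p}\big)$$ for almost every $t\in[0,\infty)$; if moreover $\theta$ is continuous, this holds for every $t\in[0,\infty)$. -/

import Mathlib

open MeasureTheory Set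
open scoped ContDiff

namespace HalfSpaceModel

/-- The open upper half-space `ℝⁿ₊ = {z | 0 < zₙ}`, the underlying set of the Poincaré half-space
model of the hyperbolic space `ℍⁿ`. The index `⊤ : Fin n` is the last one. -/
def halfSpace (n : ℕ) [NeZero n] : Set (EuclideanSpace ℝ (Fin n)) :=
  {z | 0 < z ⊤}

/-- The hyperbolic distance `d(x, y) = 2 sinh⁻¹ (|x - y| / (2 √(xₙ yₙ)))` in the half-space
model. -/
noncomputable def hypDist {n : ℕ} [NeZero n] (x y : EuclideanSpace ℝ (Fin n)) : ℝ :=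
  2 * Real.arsinh (dist x y / (2 * √(x ⊤ * y ⊤)))

/-- The Riemannian volume `dz / zₙⁿ` of the hyperbolic metric `|dz|² / zₙ²` on the half-space. -/
noncomputable def hypVolume (n : ℕ) [NeZero n] : Measure (EuclideanSpace ℝ (Fin n)) :=
  (volume.restrict (halfSpace n)).withDensity fun z => ENNReal.ofReal (1 / z ⊤ ^ n)

/-- The norm of a covector `ℓ` at the point `z` that is dual to the hyperbolic norm `|v| / zₙ` of
tangent vectors. It equals `zₙ` times the Euclidean (operator) norm of `ℓ`. -/
noncomputable def hypConorm {n : ℕ} [NeZero n] (z : EuclideanSpace ℝ (Fin n))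
    (l : EuclideanSpace ℝ (Fin n) →L[ℝ] ℝ) : ℝ :=
  z ⊤ * ‖l‖

/-- `u ∈ W^{1,1}_loc` of the open half-space, with weak derivative `Du`: both are locally integrable
in the open half-space and the integration by parts formula holds against all test functions
`φ ∈ C_c^∞` of the open half-space. Values outside the half-space play no role. -/
structure HasWeakDeriv {n : ℕ} [NeZero n] (u : EuclideanSpace ℝ (Fin n) → ℝ)
    (Du : EuclideanSpace ℝ (Fin n) → EuclideanSpace ℝ (Fin n) →L[ℝ] ℝ) : Prop where
  locallyIntegrable : LocallyIntegrableOn u (halfSpace n) volume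
  locallyIntegrable_deriv : LocallyIntegrableOn Du (halfSpace n) volume
  integral_by_parts : ∀ φ : EuclideanSpace ℝ (Fin n) → ℝ, ContDiff ℝ ∞ φ → HasCompactSupport φ →
    tsupport φ ⊆ halfSpace n → ∀ v : EuclideanSpace ℝ (Fin n),
      ∫ z in halfSpace n, u z * fderiv ℝ φ z v = -∫ z in halfSpace n, Du z v * φ z

/-- `u` belongs to the homogeneous Sobolev space `Ẇ^{1,p}(ℍⁿ)` and `Du` is its weak derivative:
`u` is weakly differentiable and the `p`-th power of the hyperbolic norm of `Du` is integrable
for the hyperbolic volume. -/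
structure HasSobolevDeriv {n : ℕ} [NeZero n] (p : ℝ) (u : EuclideanSpace ℝ (Fin n) → ℝ)
    (Du : EuclideanSpace ℝ (Fin n) → EuclideanSpace ℝ (Fin n) →L[ℝ] ℝ) : Prop where
  hasWeakDeriv : HasWeakDeriv u Du
  integrable_conorm : Integrable (fun z => hypConorm z (Du z) ^ p) (hypVolume n)

/-- The norm `(∫_{ℍⁿ} |Du|ᵖ)^{1/p}`. -/
noncomputable def hypNorm {n : ℕ} [NeZero n] (p : ℝ)
    (Du : EuclideanSpace ℝ (Fin n) → EuclideanSpace ℝ (Fin n) →L[ℝ] ℝ) : ℝ :=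
  (∫ z, hypConorm z (Du z) ^ p ∂hypVolume n) ^ (1 / p)

end HalfSpaceModel

open HalfSpaceModel

namespace HalfSpaceModel

open Filter Topology Metric

set_option linter.unusedSectionVars false

variable {n : ℕ} [NeZero n]

local notation "E" => EuclideanSpace ℝ (Fin n)

/-! Write α = 1 - n/p. The upper bound rests on mollified averages of u over Euclidean balls of
radius r ≤ xₙ/2. When the centre moves with velocity v and the radius with velocity w, integration
by parts puts the derivative of the average on Du, and Hölder's inequality on the ball bounds it by
a multiple of (|v| + |w|) r^(α-1) xₙ^(-α) times the p-th root of the energy in the ball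
(`exists_smoothAvg_deriv_bound`).

Close points: since α > 0, this bound can be integrated down to radius 0, which compares u with its
averages at Lebesgue points. Moving the centre at the fixed radius |x - y| then gives the Hölder
exponent α.

Distant points: averages at radius zₙ/4 are compared along a path that climbs vertically from x to
height 4|x - y|, crosses horizontally, and descends to y. The climb is cut into dyadic slabs. Their
energies add up with bounded overlap, so Hölder's inequality for sums over K slabs gives K^(1-1/p)
rather than K (`exists_unitAvg_vertical_bound`), and K is controlled by d(x, y) (`log_le_hypDist`).

Sharpness is tested near the points at heights e^(t/2) and e^(-t/2) of a vertical geodesic, which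
are at distance t. For t ≤ 1 a bump of width t is almost extremal. For t ≥ 1 a truncation of log |z|
oscillates by t with energy of order t. The hypothesis on θ holds only for almost every pair; a null
set of pairs is converted into a null set of distances by sliding one point vertically
(`exists_nhds_ae_of_ae_hypDist`). -/

/-! ### Heights and localization in the half-space. -/

theorem abs_coord_sub_le (z x : E) : |z ⊤ - x ⊤| ≤ dist z x := by
  have h := PiLp.norm_apply_le (z - x) ⊤
  rw [dist_eq_norm]
  simpa using h

theorem coord_bounds_of_mem_closedBall {z x : E} {r : ℝ} (h : z ∈ closedBall x r) :
    x ⊤ - r ≤ z ⊤ ∧ z ⊤ ≤ x ⊤ + r := by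
  have h1 := abs_le.1 ((abs_coord_sub_le z x).trans (mem_closedBall.1 h))
  constructor <;> linarith [h1.1, h1.2]

theorem continuous_lastCoord : Continuous (fun z : E => z ⊤) := by fun_prop

variable (n) in
theorem isOpen_halfSpace : IsOpen (halfSpace n) :=
  isOpen_lt continuous_const continuous_lastCoord

variable (n) in
theorem measurableSet_halfSpace : MeasurableSet (halfSpace n) := (isOpen_halfSpace n).measurableSet

theorem closedBall_subset_halfSpace {x : E} {r : ℝ} (hr : r < x ⊤) :
    closedBall x r ⊆ halfSpace n := fun z hz => by
  have := (coord_bounds_of_mem_closedBall hz).1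
  change 0 < z ⊤
  linarith

/-- A locally integrable function times a continuous function that vanishes off a compact subset of
the half-space is integrable on the half-space. -/
theorem integrableOn_smul_of_compact {F : Type*} [NormedAddCommGroup F] [NormedSpace ℝ F]
    {f : E → F} (hf : LocallyIntegrableOn f (halfSpace n) volume) {φ : E → ℝ} (hφ : Continuous φ)
    {K : Set E} (hK : IsCompact K) (hKH : K ⊆ halfSpace n) (h0 : ∀ z, z ∉ K → φ z = 0) :
    IntegrableOn (fun z => φ z • f z) (halfSpace n) := by
  have h1 : IntegrableOn f K := hf.integrableOn_compact_subset hKH hK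
  have h2 : IntegrableOn (fun z => φ z • f z) K := h1.continuousOn_smul hφ.continuousOn hK
  refine Integrable.integrableOn ((integrableOn_iff_integrable_of_support_subset ?_).1 h2)
  intro z hz
  by_contra h
  exact hz (by simp [h0 z h])

/-! ### Mollified averages and their variation in centre and radius. -/

variable (n) in
/-- A fixed smooth mollifier, supported in the closed unit ball. -/
noncomputable def mollifier : E → ℝ :=
  (⟨1 / 2, 1, by norm_num, by norm_num⟩ : ContDiffBump (0 : E)).normed volume

variable (n) in
theorem contDiff_mollifier : ContDiff ℝ ∞ (mollifier n) := ContDiffBump.contDiff_normed _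

variable (n) in
theorem integral_mollifier : ∫ z, mollifier n z = 1 := ContDiffBump.integral_normed _

theorem mollifier_nonneg (z : E) : 0 ≤ mollifier n z := ContDiffBump.nonneg_normed _ _

variable (n) in
theorem tsupport_mollifier : tsupport (mollifier n) = closedBall 0 1 :=
  ContDiffBump.tsupport_normed_eq _

theorem mollifier_eq_zero {z : E} (hz : 1 < ‖z‖) : mollifier n z = 0 := by
  apply image_eq_zero_of_notMem_tsupport
  rw [tsupport_mollifier]
  simpa using hz

theorem fderiv_mollifier_eq_zero {z : E} (hz : 1 < ‖z‖) : fderiv ℝ (mollifier n) z = 0 := by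
  by_contra h
  have := support_fderiv_subset ℝ (f := mollifier n) (Function.mem_support.2 h)
  rw [tsupport_mollifier] at this
  simp at this
  linarith

variable (n) in
theorem exists_mollifier_bound :
    ∃ M : ℝ, 0 < M ∧ ∀ z, mollifier n z ≤ M ∧ ‖fderiv ℝ (mollifier n) z‖ ≤ M := by
  have hc : HasCompactSupport (mollifier n) := ContDiffBump.hasCompactSupport_normed _
  obtain ⟨A, hA⟩ := hc.exists_bound_of_continuous (contDiff_mollifier n).continuous
  obtain ⟨B, hB⟩ := (hc.fderiv ℝ).exists_bound_of_continuous
    ((contDiff_mollifier n).continuous_fderiv (by simp))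
  refine ⟨max 1 (max A B), by positivity, fun z => ⟨?_, ?_⟩⟩
  · exact (le_abs_self _).trans ((hA z).trans (by simp))
  · exact (hB z).trans (by simp)

/-- The mollifier rescaled to the ball of center `x` and radius `r`. -/
noncomputable def kernel (x : E) (r : ℝ) (z : E) : ℝ :=
  (r ^ n)⁻¹ * mollifier n (r⁻¹ • (z - x))

/-- The derivative of `kernel` when the center moves with velocity `v` and the radius with
velocity `w`. -/
noncomputable def kernelDeriv (v : E) (w : ℝ) (x : E) (r : ℝ) (z : E) : ℝ :=
  -((r ^ (n + 1))⁻¹ * (n * w * mollifier n (r⁻¹ • (z - x)) +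
    fderiv ℝ (mollifier n) (r⁻¹ • (z - x)) (v + w • (r⁻¹ • (z - x)))))

/-- The average of `u` on the ball of center `x` and radius `r`, weighted by the mollifier. -/
noncomputable def smoothAvg (u : E → ℝ) (x : E) (r : ℝ) : ℝ :=
  ∫ z in halfSpace n, u z * kernel x r z

theorem one_lt_norm_rescaled {x z : E} {r : ℝ} (hr : 0 < r) (hz : z ∉ closedBall x r) :
    1 < ‖r⁻¹ • (z - x)‖ := by
  rw [norm_smul, norm_inv, Real.norm_of_nonneg hr.le, ← dist_eq_norm, inv_mul_eq_div,
    one_lt_div hr]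
  simpa using hz

theorem kernel_eq_zero {x z : E} {r : ℝ} (hr : 0 < r) (hz : z ∉ closedBall x r) :
    kernel x r z = 0 := by
  simp [kernel, mollifier_eq_zero (one_lt_norm_rescaled hr hz)]

theorem kernelDeriv_eq_zero {v x z : E} {w r : ℝ} (hr : 0 < r) (hz : z ∉ closedBall x r) :
    kernelDeriv v w x r z = 0 := by
  simp [kernelDeriv, mollifier_eq_zero (one_lt_norm_rescaled hr hz),
    fderiv_mollifier_eq_zero (one_lt_norm_rescaled hr hz)]

theorem contDiff_kernel (x : E) (r : ℝ) : ContDiff ℝ ∞ (kernel x r) := by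
  have := contDiff_mollifier n
  unfold kernel
  fun_prop

theorem continuous_kernelDeriv (v : E) (w : ℝ) (x : E) (r : ℝ) :
    Continuous (kernelDeriv v w x r) := by
  have h1 := (contDiff_mollifier n).continuous
  have h2 := (contDiff_mollifier n).continuous_fderiv (by simp)
  unfold kernelDeriv
  fun_prop

theorem hasDerivAt_kernel (v : E) (w : ℝ) (x : E) (r : ℝ) (z : E) (s : ℝ) (hr : r + s * w ≠ 0) :
    HasDerivAt (fun s => kernel (x + s • v) (r + s * w) z)
      (kernelDeriv v w (x + s • v) (r + s * w) z) s := by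
  unfold kernel kernelDeriv
  have hR : HasDerivAt (fun s : ℝ => r + s * w) w s := by
    simpa using ((hasDerivAt_id s).mul_const w).const_add r
  have hX : HasDerivAt (fun s : ℝ => z - (x + s • v)) (-v) s := by
    simpa using (((hasDerivAt_id s).smul_const v).const_add x).const_sub z
  have hζ := (hR.inv hr).smul hX
  have hd : HasFDerivAt (mollifier n) (fderiv ℝ (mollifier n) ((r + s * w)⁻¹ • (z - (x + s • v))))
      ((r + s * w)⁻¹ • (z - (x + s • v))) :=
    ((contDiff_mollifier n).differentiable (by simp) _).hasFDerivAt
  have hm := hd.comp_hasDerivAt s hζ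
  have hp := ((hR.pow n).inv (pow_ne_zero n hr)).mul hm
  refine hp.congr_deriv ?_
  change -(↑n * (r + s * w) ^ (n - 1) * w) / ((r + s * w) ^ n) ^ 2 *
      mollifier n ((r + s * w)⁻¹ • (z - (x + s • v))) + ((r + s * w) ^ n)⁻¹ *
      fderiv ℝ (mollifier n) ((r + s * w)⁻¹ • (z - (x + s • v)))
        ((r + s * w)⁻¹ • -v + (-w / (r + s * w) ^ 2) • (z - (x + s • v))) = _
  set R := r + s * w with hRdef
  set y := z - (x + s • v)
  -- The truncated subtraction `n - 1` is harmless because `n` is nonzero.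
  have hpow : (n : ℝ) * R ^ (n - 1) * R = n * R ^ n := by
    rw [mul_assoc, ← pow_succ, Nat.sub_add_cancel (NeZero.one_le)]
  have h3 : ((n : ℝ) * R ^ (n - 1)) = n * R ^ n / R := by
    field_simp
    linarith
  rw [h3]
  simp only [map_add, smul_neg, map_neg, map_smul, smul_eq_mul]
  field_simp
  ring

/-- On the support the rescaled variable lies in the unit ball, so the transport field is at most
‖v‖ + |w|. Uniformity in the centre and radius provides the dominating function for differentiation
under the integral. -/
theorem exists_kernelDeriv_bound (v : E) (w : ℝ) :
    ∃ M : ℝ, 0 ≤ M ∧ ∀ (x : E) (r : ℝ) (z : E), 0 < r →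
      |kernelDeriv v w x r z| ≤ (r ^ (n + 1))⁻¹ * M := by
  obtain ⟨M, hM, hb⟩ := exists_mollifier_bound n
  refine ⟨n * |w| * M + M * (‖v‖ + |w|), by positivity, fun x r z hr => ?_⟩
  by_cases hz : z ∈ closedBall x r
  · have hζ : ‖r⁻¹ • (z - x)‖ ≤ 1 := by
      rw [norm_smul, norm_inv, Real.norm_of_nonneg hr.le, ← dist_eq_norm, inv_mul_eq_div,
        div_le_one hr]
      simpa using hz
    unfold kernelDeriv
    rw [abs_neg, abs_mul, abs_of_pos (by positivity : 0 < (r ^ (n + 1))⁻¹)]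
    gcongr
    set ζ := r⁻¹ • (z - x)
    refine (abs_add_le _ _).trans (add_le_add ?_ ?_)
    · rw [abs_mul, abs_mul, Nat.abs_cast, abs_of_nonneg (mollifier_nonneg ζ)]
      gcongr
      exact (hb ζ).1
    · refine ((fderiv ℝ (mollifier n) ζ).le_opNorm (v + w • ζ)).trans ?_
      gcongr
      · exact (hb ζ).2
      · refine (norm_add_le _ _).trans ?_
        gcongr
        rw [norm_smul, Real.norm_eq_abs]
        exact mul_le_of_le_one_right (abs_nonneg _) hζ
  · rw [kernelDeriv_eq_zero hr hz]
    simp only [abs_zero]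
    positivity

theorem hasDerivAt_smoothAvg {u : E → ℝ} (hu : LocallyIntegrableOn u (halfSpace n) volume)
    (v : E) (w : ℝ) {x : E} {r : ℝ} (hr : 0 < r) (hrx : r < x ⊤) :
    HasDerivAt (fun s : ℝ => smoothAvg u (x + s • v) (r + s * w))
      (∫ z in halfSpace n, u z * kernelDeriv v w x r z) 0 := by
  obtain ⟨M, hM0, hM⟩ := exists_kernelDeriv_bound v w
  -- For |s| < δ the radius stays at least r/2 and all the moving balls stay in one compact ball of
  -- radius R < xₙ. The summand 1 in `L` keeps the division meaningful when v and w vanish.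
  set L := ‖v‖ + |w| + 1 with hL
  have hLpos : 0 < L := by positivity
  set δ := min (r / 2) ((x ⊤ - r) / 2) / L with hδ
  have hδpos : 0 < δ := by
    have : 0 < x ⊤ - r := by linarith
    positivity
  have hδL : δ * L = min (r / 2) ((x ⊤ - r) / 2) := by
    rw [hδ]; field_simp
  set R := r + min (r / 2) ((x ⊤ - r) / 2) with hR
  have hRx : R < x ⊤ := by
    have := min_le_right (r / 2) ((x ⊤ - r) / 2)
    linarith
  have hsmall : ∀ s ∈ ball (0 : ℝ) δ, r / 2 ≤ r + s * w ∧
      closedBall (x + s • v) (r + s * w) ⊆ closedBall x R := by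
    intro s hs
    have hs' : |s| < δ := by simpa using hs
    have h1 : |s| * ‖v‖ + |s| * |w| ≤ δ * L := by
      rw [← mul_add]
      gcongr
      linarith
    have h2 : |s * w| ≤ δ * L := by
      rw [abs_mul]
      have : 0 ≤ |s| * ‖v‖ := by positivity
      linarith
    have h3 := abs_le.1 h2
    constructor
    · have := min_le_left (r / 2) ((x ⊤ - r) / 2)
      linarith
    · apply closedBall_subset_closedBall'
      have h4 : dist (x + s • v) x = |s| * ‖v‖ := by
        simp [dist_eq_norm, norm_smul]
      rw [h4, hR, ← hδL]
      have := le_abs_self (s * w)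
      rw [abs_mul] at this
      linarith
  have hKc : IsCompact (closedBall x R) := isCompact_closedBall _ _
  have hKH : closedBall x R ⊆ halfSpace n := closedBall_subset_halfSpace hRx
  have hum : AEStronglyMeasurable u (volume.restrict (halfSpace n)) := hu.aestronglyMeasurable
  have hint : ∀ s ∈ ball (0 : ℝ) δ,
      Integrable (fun z => u z * kernel (x + s • v) (r + s * w) z)
        (volume.restrict (halfSpace n)) := by
    intro s hs
    have := integrableOn_smul_of_compact hu (contDiff_kernel (x + s • v) (r + s * w)).continuous hKc
      hKH fun z hz => kernel_eq_zero (by linarith [(hsmall s hs).1])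
        fun h => hz ((hsmall s hs).2 h)
    simp only [smul_eq_mul, mul_comm (kernel _ _ _)] at this
    exact this
  have hball : ball (0 : ℝ) δ ∈ 𝓝 (0 : ℝ) := ball_mem_nhds _ hδpos
  have key := hasDerivAt_integral_of_dominated_loc_of_deriv_le (μ := volume.restrict (halfSpace n))
    (F := fun s z => u z * kernel (x + s • v) (r + s * w) z)
    (F' := fun s z => u z * kernelDeriv v w (x + s • v) (r + s * w) z) (x₀ := (0 : ℝ))
    (bound := (closedBall x R).indicator fun z => ‖u z‖ * (((r / 2) ^ (n + 1))⁻¹ * M)) hball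
    (by filter_upwards [hball] with s hs using (hint s hs).aestronglyMeasurable)
    (hint 0 (mem_ball_self hδpos))
    (hum.mul (continuous_kernelDeriv _ _ _ _).aestronglyMeasurable)
    (by
      refine Eventually.of_forall fun z s hs => ?_
      have hrs := (hsmall s hs).1
      by_cases hz : z ∈ closedBall x R
      · rw [indicator_of_mem hz, norm_mul]
        gcongr
        refine (hM _ _ _ (by linarith)).trans ?_
        gcongr
      · rw [indicator_of_notMem hz, kernelDeriv_eq_zero (by linarith)
          fun h => hz ((hsmall s hs).2 h)]
        simp)
    (by
      refine Integrable.restrict ?_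
      rw [integrable_indicator_iff isClosed_closedBall.measurableSet]
      exact (hu.integrableOn_compact_subset hKH hKc).norm.mul_const _)
    (by
      refine Eventually.of_forall fun z s hs => ?_
      exact (hasDerivAt_kernel v w x r z s (by linarith [(hsmall s hs).1])).const_mul (u z))
  simpa [smoothAvg] using key.2

/-- This is the continuity equation: the kernel has constant mass and is transported by the field v
+ w (z - x)/r, so its rate of change is minus the divergence of field times kernel. -/
theorem sum_fderiv_field_kernel (v : E) (w : ℝ) (x : E) {r : ℝ} (hr : 0 < r) (z : E) :
    ∑ i, fderiv ℝ (fun z : E => (v i + w * (r⁻¹ * (z i - x i))) * kernel x r z) z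
      (EuclideanSpace.single i 1) = -kernelDeriv v w x r z := by
  have hk : HasFDerivAt (kernel x r)
      ((r ^ n)⁻¹ • (fderiv ℝ (mollifier n) (r⁻¹ • (z - x))).comp
        (r⁻¹ • ContinuousLinearMap.id ℝ E)) z := by
    have hd : HasFDerivAt (mollifier n) (fderiv ℝ (mollifier n) (r⁻¹ • (z - x)))
      (r⁻¹ • (z - x)) := ((contDiff_mollifier n).differentiable (by simp) _).hasFDerivAt
    exact (hd.comp z (((hasFDerivAt_id z).sub_const x).const_smul r⁻¹)).const_mul _
  have hc : ∀ i, HasFDerivAt (fun z : E => v i + w * (r⁻¹ * (z i - x i)))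
      (w • (r⁻¹ • (EuclideanSpace.proj i : E →L[ℝ] ℝ))) z := fun i =>
    ((((EuclideanSpace.proj i : E →L[ℝ] ℝ).hasFDerivAt.sub_const (x i)).const_mul r⁻¹).const_mul
      w).const_add (v i)
  have hval : ∀ i, fderiv ℝ (fun z : E => (v i + w * (r⁻¹ * (z i - x i))) * kernel x r z) z
      (EuclideanSpace.single i 1) = (w * r⁻¹) * kernel x r z +
        (r ^ n)⁻¹ * r⁻¹ * fderiv ℝ (mollifier n) (r⁻¹ • (z - x))
          ((v i + w * (r⁻¹ * (z i - x i))) • EuclideanSpace.single i 1) := fun i => by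
    have h := (hc i).mul hk
    rw [HasFDerivAt.fderiv (f := fun z : E => (v i + w * (r⁻¹ * (z i - x i))) * kernel x r z) h]
    simp
    ring
  simp_rw [hval]
  rw [Finset.sum_add_distrib, ← Finset.mul_sum (f := fun i => fderiv ℝ (mollifier n) (r⁻¹ • (z - x))
    ((v i + w * (r⁻¹ * (z i - x i))) • EuclideanSpace.single i 1)), ← map_sum]
  have hbasis : ∑ i, (v i + w * (r⁻¹ * (z i - x i))) • EuclideanSpace.single i (1 : ℝ) =
      v + w • (r⁻¹ • (z - x)) := by
    ext j
    simp [Finset.sum_apply, Pi.single_apply]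
  rw [hbasis]
  simp only [Finset.sum_const, Finset.card_univ, Fintype.card_fin, nsmul_eq_mul, kernel,
    kernelDeriv]
  field_simp
  ring

theorem integral_mul_kernelDeriv {u : E → ℝ} {Du : E → E →L[ℝ] ℝ} (hu : HasWeakDeriv u Du)
    (v : E) (w : ℝ) {x : E} {r : ℝ} (hr : 0 < r) (hrx : r < x ⊤) :
    ∫ z in halfSpace n, u z * kernelDeriv v w x r z =
      ∫ z in halfSpace n, Du z (v + w • (r⁻¹ • (z - x))) * kernel x r z := by
  have hKc : IsCompact (closedBall x r) := isCompact_closedBall _ _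
  have hKH : closedBall x r ⊆ halfSpace n := closedBall_subset_halfSpace hrx
  -- The components of the transport field times the kernel serve as test functions, one for each
  -- coordinate direction.
  set φ : Fin n → E → ℝ := fun i z => (v i + w * (r⁻¹ * (z i - x i))) * kernel x r z with hφ
  have hsm : ∀ i, ContDiff ℝ ∞ (φ i) := fun i => by
    have := contDiff_kernel x r
    simp only [hφ]
    fun_prop
  have h0 : ∀ i z, z ∉ closedBall x r → φ i z = 0 := fun i z hz => by
    simp [hφ, kernel_eq_zero hr hz]
  have hts : ∀ i, tsupport (φ i) ⊆ closedBall x r := fun i =>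
    closure_minimal (fun z hz => by
      by_contra h
      exact hz (h0 i z h)) isClosed_closedBall
  have hcs : ∀ i, HasCompactSupport (φ i) := fun i =>
    HasCompactSupport.of_support_subset_isCompact hKc (subset_closure.trans (hts i))
  have hparts : ∀ i, _ := fun i =>
    hu.integral_by_parts (φ i) (hsm i) (hcs i) ((hts i).trans hKH) (EuclideanSpace.single i 1)
  have hfd0 : ∀ i z, z ∉ closedBall x r → fderiv ℝ (φ i) z (EuclideanSpace.single i 1) = 0 := by
    intro i z hz
    have : fderiv ℝ (φ i) z = 0 := by
      by_contra h
      exact hz (hts i (support_fderiv_subset ℝ (Function.mem_support.2 h)))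
    simp [this]
  have hi1 : ∀ i, IntegrableOn (fun z => u z * fderiv ℝ (φ i) z (EuclideanSpace.single i 1))
      (halfSpace n) := fun i => by
    have := integrableOn_smul_of_compact hu.locallyIntegrable
      (((hsm i).continuous_fderiv (by simp)).clm_apply continuous_const) hKc hKH (hfd0 i)
    simpa only [smul_eq_mul, mul_comm] using this
  have hi2 : ∀ i, IntegrableOn (fun z => Du z (EuclideanSpace.single i 1) * φ i z)
      (halfSpace n) := fun i => by
    have := integrableOn_smul_of_compact hu.locallyIntegrable_deriv (hsm i).continuous hKc hKH
      (h0 i)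
    have h2 := (ContinuousLinearMap.apply ℝ ℝ (EuclideanSpace.single i (1 : ℝ))).integrable_comp
      this
    refine h2.congr (Eventually.of_forall fun z => ?_)
    simp [mul_comm]
  have e1 : ∀ z, u z * kernelDeriv v w x r z =
      -∑ i, u z * fderiv ℝ (φ i) z (EuclideanSpace.single i 1) := fun z => by
    rw [← Finset.mul_sum, sum_fderiv_field_kernel v w x hr z]
    ring
  have e2 : ∀ z, Du z (v + w • (r⁻¹ • (z - x))) * kernel x r z =
      ∑ i, Du z (EuclideanSpace.single i 1) * φ i z := fun z => by
    have hbasis : v + w • (r⁻¹ • (z - x)) =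
        ∑ i, (v i + w * (r⁻¹ * (z i - x i))) • EuclideanSpace.single i (1 : ℝ) := by
      ext j
      simp [Finset.sum_apply, Pi.single_apply]
    rw [hbasis, map_sum, Finset.sum_mul]
    refine Finset.sum_congr rfl fun i _ => ?_
    simp only [map_smul, smul_eq_mul, hφ]
    ring
  simp_rw [e1, e2]
  rw [integral_neg, integral_finsetSum _ fun i _ => hi1 i, integral_finsetSum _ fun i _ => hi2 i,
    ← Finset.sum_neg_distrib]
  exact Finset.sum_congr rfl fun i _ => by rw [hparts i, neg_neg]

/-! ### Energy as a measure, and Hölder's inequality on balls. -/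

/-- The measure with density `|Du|ᵖ` (in the hyperbolic norm) for the hyperbolic volume. -/
noncomputable def energyMeasure (p : ℝ) (Du : E → E →L[ℝ] ℝ) : Measure E :=
  (hypVolume n).withDensity fun z => ENNReal.ofReal (hypConorm z (Du z) ^ p)

variable (n) in
theorem hypVolume_absolutelyContinuous : hypVolume n ≪ volume.restrict (halfSpace n) :=
  withDensity_absolutelyContinuous _ _

variable (n) in
theorem ae_hypVolume_mem_halfSpace : ∀ᵐ z ∂hypVolume n, z ∈ halfSpace n :=
  (hypVolume_absolutelyContinuous n).ae_le (ae_restrict_mem (measurableSet_halfSpace n))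

theorem hypConorm_nonneg {z : E} (hz : z ∈ halfSpace n) (l : E →L[ℝ] ℝ) : 0 ≤ hypConorm z l :=
  mul_nonneg (le_of_lt hz) (norm_nonneg _)

theorem isFiniteMeasure_energyMeasure {p : ℝ} {u : E → ℝ} {Du : E → E →L[ℝ] ℝ}
    (hu : HasSobolevDeriv p u Du) : IsFiniteMeasure (energyMeasure p Du) :=
  ⟨by
    rw [energyMeasure, withDensity_apply _ MeasurableSet.univ, setLIntegral_univ]
    exact hu.integrable_conorm.lintegral_lt_top⟩

theorem hypNorm_eq {p : ℝ} {u : E → ℝ} {Du : E → E →L[ℝ] ℝ} (hu : HasSobolevDeriv p u Du) :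
    hypNorm p Du = (energyMeasure p Du).real univ ^ (1 / p) := by
  rw [hypNorm, measureReal_def, energyMeasure, withDensity_apply _ MeasurableSet.univ,
    setLIntegral_univ, integral_eq_lintegral_of_nonneg_ae _
      hu.integrable_conorm.aestronglyMeasurable]
  filter_upwards [ae_hypVolume_mem_halfSpace n] with z hz
  exact Real.rpow_nonneg (hypConorm_nonneg hz _) _

theorem setLIntegral_hypVolume {S : Set E} (hS : MeasurableSet S) (hSH : S ⊆ halfSpace n)
    (f : E → ENNReal) :
    ∫⁻ z in S, f z ∂hypVolume n = ∫⁻ z in S, ENNReal.ofReal (1 / z ⊤ ^ n) * f z := by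
  have hm : Measurable fun z : E => ENNReal.ofReal (1 / z ⊤ ^ n) := by fun_prop
  rw [hypVolume, setLIntegral_withDensity_eq_setLIntegral_mul_non_measurable _ hm f hS
    (Eventually.of_forall fun z => ENNReal.ofReal_lt_top),
    Measure.restrict_restrict hS, inter_eq_left.2 hSH]
  rfl

/-- The energy has Lebesgue density zₙ^(p-n) |Du|^p, and zₙ^(p-n) ≥ a^(p-n) on S because p > n. -/
theorem setLIntegral_enorm_rpow_le {p : ℝ} (hp : (n : ℝ) < p) (Du : E → E →L[ℝ] ℝ) {S : Set E}
    (hS : MeasurableSet S) {a : ℝ} (ha : 0 < a) (hSa : ∀ z ∈ S, a ≤ z ⊤) :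
    ∫⁻ z in S, ‖Du z‖ₑ ^ p ≤ ENNReal.ofReal (a ^ ((n : ℝ) - p)) * energyMeasure p Du S := by
  have hSH : S ⊆ halfSpace n := fun z hz => ha.trans_le (hSa z hz)
  rw [energyMeasure, withDensity_apply _ hS, setLIntegral_hypVolume hS hSH,
    ← lintegral_const_mul' _ _ ENNReal.ofReal_ne_top]
  refine setLIntegral_mono' hS fun z hz => ?_
  have hz0 : 0 < z ⊤ := ha.trans_le (hSa z hz)
  have hp0 : 0 < p := (Nat.cast_nonneg n).trans_lt hp
  rw [← ofReal_norm, ENNReal.ofReal_rpow_of_nonneg (norm_nonneg _) hp0.le,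
    ← ENNReal.ofReal_mul (by positivity), ← ENNReal.ofReal_mul (by positivity)]
  refine ENNReal.ofReal_le_ofReal ?_
  rw [hypConorm, Real.mul_rpow hz0.le (norm_nonneg _), ← mul_assoc, ← mul_assoc]
  refine le_mul_of_one_le_left (by positivity) ?_
  have h1 : 1 / z ⊤ ^ n * z ⊤ ^ p = z ⊤ ^ (p - n) := by
    rw [Real.rpow_sub hz0, Real.rpow_natCast]; ring
  have h2 : a ^ ((n : ℝ) - p) = (a ^ (p - n))⁻¹ := by
    rw [← Real.rpow_neg ha.le]; ring_nf
  rw [mul_assoc, h1, h2, inv_mul_eq_div, one_le_div (by positivity)]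
  exact Real.rpow_le_rpow ha.le (hSa z hz) (by linarith)

/-- Hölder's inequality against the constant 1, on a ball where the height is at least xₙ/2. The
exponent of r is written n + (α - 1) so that r^n later cancels the normalization of the kernel. -/
theorem exists_setIntegral_norm_le (p : ℝ) (hp : (n : ℝ) < p) :
    ∃ C : ℝ, 0 < C ∧ ∀ (u : E → ℝ) (Du : E → E →L[ℝ] ℝ), HasSobolevDeriv p u Du →
      ∀ (x : E) (r : ℝ), 0 < r → r ≤ x ⊤ / 2 →
        ∫ z in closedBall x r, ‖Du z‖ ≤ C * r ^ ((n : ℝ) + ((1 - n / p) - 1)) *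
          x ⊤ ^ (-(1 - n / p)) * (energyMeasure p Du).real (closedBall x r) ^ (1 / p) := by
  have hn1 : (1 : ℝ) ≤ n := by exact_mod_cast NeZero.one_le
  have hp1 : 1 < p := hn1.trans_lt hp
  have hp0 : 0 < p := by linarith
  set κ : ℝ := (volume : Measure E).real (ball 0 1) with hκ
  have hκ0 : 0 < κ := ENNReal.toReal_pos (measure_ball_pos _ _ one_pos).ne' measure_ball_lt_top.ne
  have hα0 : 0 < 1 - (n : ℝ) / p := by rw [sub_pos, div_lt_one hp0]; exact hp
  refine ⟨κ ^ (1 - 1 / p) * 2 ^ (1 - (n : ℝ) / p), by positivity, fun u Du hu x r hr hrx => ?_⟩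
  have hx : 0 < x ⊤ := by linarith
  have := isFiniteMeasure_energyMeasure hu
  set B := closedBall x r
  have hBm : MeasurableSet B := isClosed_closedBall.measurableSet
  have hBH : B ⊆ halfSpace n := closedBall_subset_halfSpace (by linarith)
  have hDi : IntegrableOn Du B :=
    hu.hasWeakDeriv.locallyIntegrable_deriv.integrableOn_compact_subset hBH
      (isCompact_closedBall _ _)
  have hvol : volume B = ENNReal.ofReal (r ^ n * κ) := by
    rw [Measure.addHaar_closedBall _ _ hr.le, ENNReal.ofReal_mul (by positivity), hκ,
      measureReal_def, ENNReal.ofReal_toReal measure_ball_lt_top.ne, finrank_euclideanSpace_fin]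
  have hhold : ∫⁻ z in B, ‖Du z‖ₑ ≤ (∫⁻ z in B, ‖Du z‖ₑ ^ p) ^ (1 / p) * volume B ^ (1 - 1 / p) := by
    have hc : p.HolderConjugate (p.conjExponent) := Real.HolderConjugate.conjExponent hp1
    have := ENNReal.lintegral_mul_le_Lp_mul_Lq (volume.restrict B) hc
      (f := fun z => ‖Du z‖ₑ) (g := fun _ => 1) hDi.aestronglyMeasurable.enorm aemeasurable_const
    have hq : 1 / p.conjExponent = 1 - 1 / p := by
      have := hc.inv_add_inv_eq_one
      rw [one_div, one_div]; linarith
    simpa [hq] using this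
  have hA := setLIntegral_enorm_rpow_le hp Du hBm (half_pos hx) fun z hz => by
    have := (coord_bounds_of_mem_closedBall hz).1
    linarith
  have hfin := hhold.trans (mul_le_mul_left (ENNReal.rpow_le_rpow hA (by positivity)) _)
  have hm : (energyMeasure p Du) B = ENNReal.ofReal ((energyMeasure p Du).real B) :=
    (ENNReal.ofReal_toReal (measure_ne_top _ _)).symm
  rw [hm, hvol, ← ENNReal.ofReal_mul (by positivity),
    ENNReal.ofReal_rpow_of_nonneg (by positivity) (by positivity),
    ENNReal.ofReal_rpow_of_nonneg (by positivity) (by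
      rw [sub_nonneg, div_le_one hp0]; exact hp1.le), ← ENNReal.ofReal_mul (by positivity),
    ← ofReal_integral_norm_eq_lintegral_enorm hDi,
    ENNReal.ofReal_le_ofReal_iff (by positivity)] at hfin
  refine hfin.trans (le_of_eq ?_)
  rw [Real.mul_rpow (by positivity) (by positivity), Real.mul_rpow (by positivity) hκ0.le,
    ← Real.rpow_mul (by positivity), ← Real.rpow_natCast, ← Real.rpow_mul hr.le]
  have e1 : (n : ℝ) * (1 - 1 / p) = n + ((1 - n / p) - 1) := by ring
  have e2 : ((n : ℝ) - p) * (1 / p) = -(1 - n / p) := by field_simp; ring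
  rw [e1, e2, Real.div_rpow hx.le (by norm_num), Real.rpow_neg (by norm_num : (0 : ℝ) ≤ 2)]
  field_simp

/-! ### Oscillation of averages at small scales. -/

/-- The set S is left free: the whole space suffices for the local estimates, whereas the vertical
chain needs a slab in order to sum energies. -/
theorem exists_smoothAvg_deriv_bound (p : ℝ) (hp : (n : ℝ) < p) :
    ∃ C : ℝ, 0 < C ∧ ∀ (u : E → ℝ) (Du : E → E →L[ℝ] ℝ), HasSobolevDeriv p u Du →
      ∀ (x v : E) (r w s : ℝ), 0 < r + s * w → r + s * w ≤ (x + s • v) ⊤ / 2 →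
        ∀ S : Set E, closedBall (x + s • v) (r + s * w) ⊆ S →
          ∃ D : ℝ, HasDerivAt (fun s : ℝ => smoothAvg u (x + s • v) (r + s * w)) D s ∧
            |D| ≤ C * (‖v‖ + |w|) * (r + s * w) ^ ((1 - n / p) - 1) *
              (x + s • v) ⊤ ^ (-(1 - n / p)) * (energyMeasure p Du).real S ^ (1 / p) := by
  have hn1 : (1 : ℝ) ≤ n := by exact_mod_cast NeZero.one_le
  have hp0 : 0 < p := by linarith
  obtain ⟨C, hC, hCb⟩ := exists_setIntegral_norm_le (n := n) p hp
  obtain ⟨M, hM, hMb⟩ := exists_mollifier_bound n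
  refine ⟨M * C, by positivity, fun u Du hu x₀ v r₀ w s hr hrx S hS => ?_⟩
  have := isFiniteMeasure_energyMeasure hu
  obtain ⟨x, hxdef⟩ : ∃ x, x = x₀ + s • v := ⟨_, rfl⟩
  obtain ⟨r, hrdef⟩ : ∃ r, r = r₀ + s * w := ⟨_, rfl⟩
  rw [← hxdef] at hrx hS ⊢
  rw [← hrdef] at hr hrx hS ⊢
  have hx : 0 < x ⊤ := by linarith
  have hd := hasDerivAt_smoothAvg hu.hasWeakDeriv.locallyIntegrable v w hr
    (by linarith : r < x ⊤)
  rw [integral_mul_kernelDeriv hu.hasWeakDeriv v w hr (by linarith)] at hd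
  refine ⟨∫ z in halfSpace n, Du z (v + w • (r⁻¹ • (z - x))) * kernel x r z, ?_, ?_⟩
  -- The derivative is known at parameter 0 of the path started at time s; translating the parameter
  -- moves it to s.
  · rw [← sub_self s] at hd
    have := hd.comp_sub_const s s
    refine this.congr_of_eventuallyEq (Eventually.of_forall fun t => ?_)
    simp only
    congr 1
    · rw [hxdef]; module
    · rw [hrdef]; ring
  · have hBm : MeasurableSet (closedBall x r) := isClosed_closedBall.measurableSet
    have hBH : closedBall x r ⊆ halfSpace n := closedBall_subset_halfSpace (by linarith)
    have hDi : IntegrableOn Du (closedBall x r) :=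
      hu.hasWeakDeriv.locallyIntegrable_deriv.integrableOn_compact_subset hBH
        (isCompact_closedBall _ _)
    have hres : ∫ z in halfSpace n, Du z (v + w • (r⁻¹ • (z - x))) * kernel x r z =
        ∫ z in closedBall x r, Du z (v + w • (r⁻¹ • (z - x))) * kernel x r z :=
      setIntegral_eq_of_subset_of_forall_sdiff_eq_zero (measurableSet_halfSpace n) hBH
        fun z hz => by rw [kernel_eq_zero hr hz.2, mul_zero]
    rw [hres]
    have hb : |∫ z in closedBall x r, Du z (v + w • (r⁻¹ • (z - x))) * kernel x r z| ≤
        ∫ z in closedBall x r, ‖Du z‖ * ((‖v‖ + |w|) * ((r ^ n)⁻¹ * M)) := by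
      rw [← Real.norm_eq_abs]
      refine norm_integral_le_of_norm_le (hDi.norm.mul_const _) ?_
      filter_upwards [ae_restrict_mem hBm] with z hz
      have hζ : ‖r⁻¹ • (z - x)‖ ≤ 1 := by
        rw [norm_smul, norm_inv, Real.norm_of_nonneg hr.le, ← dist_eq_norm, inv_mul_eq_div,
          div_le_one hr]
        simpa using hz
      rw [norm_mul, ← mul_assoc]
      gcongr
      · refine ((Du z).le_opNorm _).trans ?_
        gcongr
        refine (norm_add_le _ _).trans ?_
        gcongr
        rw [norm_smul, Real.norm_eq_abs]
        exact mul_le_of_le_one_right (abs_nonneg _) hζ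
      · rw [kernel, norm_mul, Real.norm_of_nonneg (mollifier_nonneg _),
          Real.norm_of_nonneg (by positivity)]
        gcongr
        exact (hMb _).1
    refine hb.trans ?_
    rw [integral_mul_const]
    have h1 := hCb u Du hu x r hr hrx
    have h2 : (energyMeasure p Du).real (closedBall x r) ≤ (energyMeasure p Du).real S :=
      measureReal_mono hS
    calc _ ≤ (C * r ^ ((n : ℝ) + ((1 - n / p) - 1)) *
          x ⊤ ^ (-(1 - n / p)) * (energyMeasure p Du).real S ^ (1 / p)) *
            ((‖v‖ + |w|) * ((r ^ n)⁻¹ * M)) := by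
          refine mul_le_mul_of_nonneg_right (h1.trans ?_) (by positivity)
          gcongr
      _ = _ := by
          rw [Real.rpow_add hr, Real.rpow_natCast]
          field_simp

/-- The rate r^(α-1) is integrable at 0 since α > 0, so the bound does not depend on r' and survives
the limit r' → 0. -/
theorem exists_smoothAvg_radius_bound (p : ℝ) (hp : (n : ℝ) < p) :
    ∃ C : ℝ, 0 < C ∧ ∀ (u : E → ℝ) (Du : E → E →L[ℝ] ℝ), HasSobolevDeriv p u Du →
      ∀ (x : E) (r' r : ℝ), 0 < r' → r' ≤ r → r ≤ x ⊤ / 2 →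
        |smoothAvg u x r - smoothAvg u x r'| ≤ C * (r / x ⊤) ^ (1 - n / p) * hypNorm p Du := by
  obtain ⟨C, hC, hCb⟩ := exists_smoothAvg_deriv_bound (n := n) p hp
  have hp0 : 0 < p := (Nat.cast_nonneg n).trans_lt hp
  set α := 1 - (n : ℝ) / p with hα
  have hα0 : 0 < α := by rw [hα, sub_pos, div_lt_one hp0]; exact hp
  refine ⟨C / α, by positivity, fun u Du hu x r' r hr' hrr hrx => ?_⟩
  have hx : 0 < x ⊤ := by linarith
  rw [hypNorm_eq hu]
  set N := (energyMeasure p Du).real univ ^ (1 / p)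
  have hN : 0 ≤ N := by positivity
  have hD : ∀ s ∈ Icc r' r, ∃ D : ℝ, HasDerivAt (fun s : ℝ => smoothAvg u x s) D s ∧
      |D| ≤ C * x ⊤ ^ (-α) * N * s ^ (α - 1) := fun s hs => by
    obtain ⟨D, hD, hDb⟩ := hCb u Du hu x 0 0 1 s (by linarith [hs.1]) (by simp; linarith [hs.2])
      univ (subset_univ _)
    refine ⟨D, by simpa using hD, hDb.trans (le_of_eq ?_)⟩
    change C * _ * _ * _ * N = _
    simp only [norm_zero, abs_one, zero_add, mul_one, smul_zero, add_zero]
    ring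
  choose! D hD hDb using hD
  -- The comparison function is a primitive of the bound on |D|, so no integrability of D is
  -- required.
  have key := image_norm_le_of_norm_deriv_right_le_deriv_boundary' (a := r') (b := r)
    (f := fun s => smoothAvg u x s - smoothAvg u x r') (f' := D)
    (B := fun s => C * x ⊤ ^ (-α) * N * ((s ^ α - r' ^ α) / α))
    (B' := fun s => C * x ⊤ ^ (-α) * N * s ^ (α - 1))
    (fun s hs => ((hD s hs).continuousAt.sub continuousAt_const).continuousWithinAt)
    (fun s hs => ((hD s (Ico_subset_Icc_self hs)).sub_const _).hasDerivWithinAt)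
    (by simp)
    (by
      apply ContinuousOn.mul continuousOn_const
      apply ContinuousOn.div_const
      exact (continuousOn_id.rpow_const fun s hs => Or.inr hα0.le).sub continuousOn_const)
    (fun s hs => by
      have h := (((Real.hasDerivAt_rpow_const (p := α)
        (Or.inl (by linarith [hs.1] : s ≠ 0))).sub_const (r' ^ α)).div_const α).const_mul
          (C * x ⊤ ^ (-α) * N)
      refine (h.congr_deriv ?_).hasDerivWithinAt
      field_simp)
    (fun s hs => hDb s (Ico_subset_Icc_self hs))
    (right_mem_Icc.2 hrr)
  refine key.trans ?_
  rw [Real.div_rpow (by linarith) hx.le, Real.rpow_neg hx.le]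
  have : (r ^ α - r' ^ α) / α ≤ r ^ α / α := by
    gcongr
    linarith [Real.rpow_nonneg hr'.le α]
  calc _ ≤ C * (x ⊤ ^ α)⁻¹ * N * (r ^ α / α) := by gcongr
    _ = _ := by ring

theorem integral_kernel (x : E) {r : ℝ} (hr : 0 < r) : ∫ z, kernel x r z = 1 := by
  simp only [kernel]
  rw [integral_const_mul,
    integral_sub_right_eq_self (fun z => mollifier n (r⁻¹ • z)) x,
    Measure.integral_comp_inv_smul, integral_mollifier, finrank_euclideanSpace_fin,
    abs_of_pos (by positivity)]
  simp only [smul_eq_mul, mul_one]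
  field_simp

/-- The kernel has mass 1 and is at most M r^(-n), so at a Lebesgue point the error is dominated by
the mean of |u - u(x)| on the ball. -/
theorem ae_tendsto_smoothAvg {u : E → ℝ} (hu : LocallyIntegrableOn u (halfSpace n) volume) :
    ∀ᵐ x, x ∈ halfSpace n → Tendsto (fun r => smoothAvg u x r) (𝓝[>] 0) (𝓝 (u x)) := by
  obtain ⟨M, hM, hMb⟩ := exists_mollifier_bound n
  obtain ⟨V, hVo, hVc, hVi⟩ := hu.exists_nat_integrableOn
  set κ : ℝ := (volume : Measure E).real (ball 0 1) with hκ
  have hmain : ∀ k, ∀ᵐ x, x ∈ V k ∩ halfSpace n →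
      Tendsto (fun r => smoothAvg u x r) (𝓝[>] 0) (𝓝 (u x)) := by
    intro k
    have hWo : IsOpen (V k ∩ halfSpace n) := (hVo k).inter (isOpen_halfSpace n)
    set W := V k ∩ halfSpace n
    -- Lebesgue differentiation is applied to a function integrable on the whole space, hence the
    -- cut-off to each member of a countable open exhaustion.
    have hg : Integrable (W.indicator u) := (integrable_indicator_iff hWo.measurableSet).2 (hVi k)
    filter_upwards [IsUnifLocDoublingMeasure.ae_tendsto_average_norm_sub (μ := volume)
      hg.locallyIntegrable 1] with x hx hxW
    have h1 := hx (l := 𝓝[>] (0 : ℝ)) (fun _ => x) (fun r => r) tendsto_id (by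
      filter_upwards [self_mem_nhdsWithin] with r hr
      have : (0 : ℝ) < r := hr
      simp [this.le])
    obtain ⟨R, hR, hRW⟩ := Metric.isOpen_iff.1 hWo x hxW
    rw [tendsto_iff_norm_sub_tendsto_zero]
    have h2 := h1.const_mul (M * κ)
    rw [mul_zero] at h2
    refine squeeze_zero' (Eventually.of_forall fun _ => norm_nonneg _) ?_ h2
    filter_upwards [Ioo_mem_nhdsGT hR] with r hr
    have hr0 : 0 < r := hr.1
    have hBW : closedBall x r ⊆ W := (closedBall_subset_ball hr.2).trans hRW
    have hBm : MeasurableSet (closedBall x r) := isClosed_closedBall.measurableSet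
    have huB : IntegrableOn u (closedBall x r) := (hVi k).mono_set hBW
    have hkc := (contDiff_kernel x r).continuous
    have e1 : smoothAvg u x r = ∫ z in closedBall x r, u z * kernel x r z :=
      setIntegral_eq_of_subset_of_forall_sdiff_eq_zero (measurableSet_halfSpace n)
        (hBW.trans inter_subset_right) fun z hz => by rw [kernel_eq_zero hr0 hz.2, mul_zero]
    have e2 : u x = ∫ z in closedBall x r, u x * kernel x r z := by
      rw [integral_const_mul, setIntegral_eq_integral_of_forall_compl_eq_zero fun z hz =>
        kernel_eq_zero hr0 hz, integral_kernel x hr0, mul_one]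
    have i1 : IntegrableOn (fun z => u z * kernel x r z) (closedBall x r) :=
      huB.mul_continuousOn hkc.continuousOn (isCompact_closedBall _ _)
    have i2 : IntegrableOn (fun z => u x * kernel x r z) (closedBall x r) :=
      (continuous_const.mul hkc).continuousOn.integrableOn_compact (isCompact_closedBall _ _)
    have e3 : smoothAvg u x r - u x = ∫ z in closedBall x r, (u z - u x) * kernel x r z := by
      simp only [sub_mul]
      rw [integral_sub i1 i2, ← e1, ← e2]
    rw [e3]
    have hb : ‖∫ z in closedBall x r, (u z - u x) * kernel x r z‖ ≤
        ∫ z in closedBall x r, ‖W.indicator u z - W.indicator u x‖ * ((r ^ n)⁻¹ * M) := by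
      refine norm_integral_le_of_norm_le
        ((hg.integrableOn.sub (integrableOn_const measure_closedBall_lt_top.ne)).norm.mul_const _) ?_
      filter_upwards [ae_restrict_mem hBm] with z hz
      rw [indicator_of_mem (hBW hz), indicator_of_mem hxW, norm_mul]
      gcongr
      rw [kernel, norm_mul, Real.norm_of_nonneg (mollifier_nonneg _),
        Real.norm_of_nonneg (by positivity)]
      gcongr
      exact (hMb _).1
    refine hb.trans (le_of_eq ?_)
    have hv : volume.real (closedBall x r) = r ^ n * κ := by
      rw [measureReal_def, Measure.addHaar_closedBall _ _ hr0.le, finrank_euclideanSpace_fin,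
        ENNReal.toReal_mul, ENNReal.toReal_ofReal (by positivity)]
      rfl
    have hκ0 : 0 < κ :=
      ENNReal.toReal_pos (measure_ball_pos _ _ one_pos).ne' measure_ball_lt_top.ne
    rw [integral_mul_const, setAverage_eq, hv, smul_eq_mul]
    field_simp
  filter_upwards [ae_all_iff.2 hmain] with x hx hxH
  obtain ⟨k, hk⟩ := mem_iUnion.1 (hVc hxH)
  exact hx k ⟨hk, hxH⟩

/-- A function in the Sobolev space is close to its averages on small balls. -/
theorem exists_ae_sub_smoothAvg_bound (p : ℝ) (hp : (n : ℝ) < p) :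
    ∃ C : ℝ, 0 < C ∧ ∀ (u : E → ℝ) (Du : E → E →L[ℝ] ℝ), HasSobolevDeriv p u Du →
      ∀ᵐ x, x ∈ halfSpace n → ∀ r : ℝ, 0 < r → r ≤ x ⊤ / 2 →
        |smoothAvg u x r - u x| ≤ C * (r / x ⊤) ^ (1 - n / p) * hypNorm p Du := by
  obtain ⟨C, hC, hCb⟩ := exists_smoothAvg_radius_bound (n := n) p hp
  refine ⟨C, hC, fun u Du hu => ?_⟩
  filter_upwards [ae_tendsto_smoothAvg hu.hasWeakDeriv.locallyIntegrable] with x hx hxH r hr hrx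
  refine le_of_tendsto (((hx hxH).const_sub (smoothAvg u x r)).abs) ?_
  filter_upwards [Ioo_mem_nhdsGT hr] with r' hr'
  exact hCb u Du hu x r' r hr'.1 hr'.2.le hrx

/-- The radius equals the displacement, so speed times rate is r · r^(α-1) = r^α. Along the segment
the height stays above 3xₙ/4. -/
theorem exists_smoothAvg_translate_bound (p : ℝ) (hp : (n : ℝ) < p) :
    ∃ C : ℝ, 0 < C ∧ ∀ (u : E → ℝ) (Du : E → E →L[ℝ] ℝ), HasSobolevDeriv p u Du →
      ∀ (x y : E), 0 < dist x y → dist x y ≤ x ⊤ / 4 →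
        |smoothAvg u y (dist x y) - smoothAvg u x (dist x y)| ≤
          C * (dist x y / x ⊤) ^ (1 - n / p) * hypNorm p Du := by
  obtain ⟨C, hC, hCb⟩ := exists_smoothAvg_deriv_bound (n := n) p hp
  have hp0 : 0 < p := (Nat.cast_nonneg n).trans_lt hp
  set α := 1 - (n : ℝ) / p with hα
  have hα0 : 0 < α := by rw [hα, sub_pos, div_lt_one hp0]; exact hp
  refine ⟨C * (3 / 4) ^ (-α), by positivity, fun u Du hu x y hr hrx => ?_⟩
  set r := dist x y with hrdef
  have hx : 0 < x ⊤ := by linarith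
  rw [hypNorm_eq hu]
  set N := (energyMeasure p Du).real univ ^ (1 / p)
  have hN : 0 ≤ N := by positivity
  have hD : ∀ s ∈ Icc (0 : ℝ) 1, ∃ D : ℝ,
      HasDerivAt (fun s : ℝ => smoothAvg u (x + s • (y - x)) r) D s ∧
      |D| ≤ C * (3 / 4) ^ (-α) * (r / x ⊤) ^ α * N := fun s hs => by
    have hz : 3 / 4 * x ⊤ ≤ (x + s • (y - x)) ⊤ := by
      have h1 : x + s • (y - x) ∈ closedBall x r := by
        rw [mem_closedBall, dist_eq_norm, add_sub_cancel_left, norm_smul, ← dist_eq_norm,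
          dist_comm y x, ← hrdef, Real.norm_of_nonneg hs.1]
        exact mul_le_of_le_one_left hr.le hs.2
      linarith [(coord_bounds_of_mem_closedBall h1).1]
    obtain ⟨D, hD, hDb⟩ := hCb u Du hu x (y - x) r 0 s (by simpa using hr) (by linarith)
      univ (subset_univ _)
    refine ⟨D, by simpa using hD, hDb.trans ?_⟩
    have hle : (x + s • (y - x)) ⊤ ^ (-α) ≤ (3 / 4 * x ⊤) ^ (-α) :=
      Real.rpow_le_rpow_of_nonpos (by positivity) hz (by linarith)
    rw [← dist_eq_norm, dist_comm y x, ← hrdef, abs_zero, add_zero, mul_zero, add_zero]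
    calc _ ≤ C * r * r ^ (α - 1) * (3 / 4 * x ⊤) ^ (-α) * N := by gcongr
      _ = _ := by
        rw [Real.mul_rpow (by norm_num) hx.le, Real.rpow_sub_one hr.ne', Real.rpow_neg hx.le,
          Real.div_rpow hr.le hx.le]
        field_simp
  choose! D hD hDb using hD
  have key := (convex_Icc (0 : ℝ) 1).norm_image_sub_le_of_norm_hasDerivWithin_le
    (fun s hs => (hD s hs).hasDerivWithinAt) hDb (left_mem_Icc.2 zero_le_one)
    (right_mem_Icc.2 zero_le_one)
  simpa using key

/-! ### Averages at unit hyperbolic scale and dyadic vertical chains. -/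

/-- The average at the scale of the hyperbolic structure. -/
noncomputable def unitAvg (u : E → ℝ) (x : E) : ℝ := smoothAvg u x (x ⊤ / 4)

variable (n) in
/-- The horizontal slab `a ≤ zₙ ≤ b`. -/
def slab (a b : ℝ) : Set E := {z | a ≤ z ⊤ ∧ z ⊤ ≤ b}

/-- With radius t/4 at height t the two powers combine to a multiple of 1/t ≤ 1/a. A ball of radius
t/4 around a point of the slab stays in the enlarged slab, which keeps the energy localized. -/
theorem exists_unitAvg_sub_bound (p : ℝ) (hp : (n : ℝ) < p) :
    ∃ C : ℝ, 0 < C ∧ ∀ (u : E → ℝ) (Du : E → E →L[ℝ] ℝ), HasSobolevDeriv p u Du →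
      ∀ (x y : E) (a b : ℝ), 0 < a → x ∈ slab n a b → y ∈ slab n a b →
        |unitAvg u y - unitAvg u x| ≤ C * (dist x y / a) *
          (energyMeasure p Du).real (slab n (3 / 4 * a) (5 / 4 * b)) ^ (1 / p) := by
  obtain ⟨C, hC, hCb⟩ := exists_smoothAvg_deriv_bound (n := n) p hp
  have hp0 : 0 < p := (Nat.cast_nonneg n).trans_lt hp
  set α := 1 - (n : ℝ) / p with hα
  refine ⟨C * (5 / 4) * (1 / 4) ^ (α - 1), by positivity, fun u Du hu x y a b ha hx hy => ?_⟩
  set S := slab n (3 / 4 * a) (5 / 4 * b)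
  set N := (energyMeasure p Du).real S ^ (1 / p)
  have hN : 0 ≤ N := by positivity
  have hD : ∀ s ∈ Icc (0 : ℝ) 1, ∃ D : ℝ,
      HasDerivAt (fun s : ℝ => smoothAvg u (x + s • (y - x)) (x ⊤ / 4 + s * ((y ⊤ - x ⊤) / 4))) D s ∧
      |D| ≤ C * (5 / 4) * (1 / 4) ^ (α - 1) * (dist x y / a) * N := fun s hs => by
    have hcoord : (x + s • (y - x)) ⊤ = x ⊤ + s * (y ⊤ - x ⊤) := by simp
    have hrad : x ⊤ / 4 + s * ((y ⊤ - x ⊤) / 4) = (x + s • (y - x)) ⊤ / 4 := by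
      rw [hcoord]; ring
    have hza : a ≤ (x + s • (y - x)) ⊤ := by
      rw [hcoord]; nlinarith [hs.1, hs.2, hx.1, hy.1]
    have hzb : (x + s • (y - x)) ⊤ ≤ b := by
      rw [hcoord]; nlinarith [hs.1, hs.2, hx.2, hy.2]
    have hz0 : 0 < (x + s • (y - x)) ⊤ := ha.trans_le hza
    obtain ⟨D, hD, hDb⟩ := hCb u Du hu x (y - x) (x ⊤ / 4) ((y ⊤ - x ⊤) / 4) s
      (by rw [hrad]; positivity) (by rw [hrad]; linarith) S (by
        rw [hrad]
        intro z hz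
        have := coord_bounds_of_mem_closedBall hz
        constructor <;> linarith [this.1, this.2])
    refine ⟨D, hD, hDb.trans ?_⟩
    rw [hrad]
    set t := (x + s • (y - x)) ⊤
    -- The radius moves at most a quarter as fast as the centre; this is the factor 5/4 in the
    -- constant.
    have hw : |(y ⊤ - x ⊤) / 4| ≤ dist x y / 4 := by
      rw [abs_div, abs_of_pos (by norm_num : (0 : ℝ) < 4), dist_comm]
      gcongr
      exact abs_coord_sub_le y x
    have hpow : (t / 4) ^ (α - 1) * t ^ (-α) = (1 / 4) ^ (α - 1) * t⁻¹ := by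
      rw [div_eq_mul_one_div, Real.mul_rpow hz0.le (by norm_num), mul_comm (t ^ (α - 1)), mul_assoc,
        ← Real.rpow_add hz0, ← Real.rpow_neg_one]
      ring_nf
    rw [← dist_eq_norm, dist_comm y x, mul_assoc C, mul_assoc C, mul_assoc (_ + _), hpow]
    calc _ ≤ C * ((dist x y + dist x y / 4) * ((1 / 4) ^ (α - 1) * a⁻¹)) * N := by gcongr
      _ = _ := by ring
  choose! D hD hDb using hD
  have key := (convex_Icc (0 : ℝ) 1).norm_image_sub_le_of_norm_hasDerivWithin_le
    (fun s hs => (hD s hs).hasDerivWithinAt) hDb (left_mem_Icc.2 zero_le_one)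
    (right_mem_Icc.2 zero_le_one)
  have e : x ⊤ / 4 + (y ⊤ - x ⊤) / 4 = y ⊤ / 4 := by ring
  simpa [e, unitAvg] using key

theorem measurableSet_dyadicSlab (a b : ℝ) : MeasurableSet {z : E | z ⊤ ∈ Ico a b} :=
  continuous_lastCoord.measurable measurableSet_Ico

theorem sum_dyadicSlab_le (μ : Measure E) [IsFiniteMeasure μ] {a : ℝ} (ha : 0 < a) (i K : ℕ) :
    ∑ k ∈ Finset.range K, μ.real {z : E | z ⊤ ∈ Ico (2 ^ (k + i) * a) (2 ^ (k + i + 1) * a)} ≤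
      μ.real univ := by
  rw [← measureReal_biUnion_finset]
  · exact measureReal_mono (subset_univ _)
  · intro k _ l _ hkl
    have hm : Monotone fun k : ℕ => (2 : ℝ) ^ (k + i) * a := fun k l h => by
      have : (2 : ℝ) ^ (k + i) ≤ 2 ^ (l + i) := pow_le_pow_right₀ one_le_two (by omega)
      simp only
      gcongr
    have := hm.pairwise_disjoint_on_Ico_succ hkl
    simp only [Function.onFun, Order.succ_eq_add_one] at this ⊢
    rw [add_right_comm k 1 i, add_right_comm l 1 i] at this
    exact Set.disjoint_left.2 fun z h1 h2 => Set.disjoint_left.1 this h1 h2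
  · exact fun k _ => measurableSet_dyadicSlab _ _

/-- The k-th enlarged slab ranges over heights from 3/4 to 5/2 times 2^k a, so the three consecutive
dyadic intervals from 2^k a/2 to 4 · 2^k a cover it. -/
theorem sum_slab_le (μ : Measure E) [IsFiniteMeasure μ] {a : ℝ} (ha : 0 < a) (K : ℕ) :
    ∑ k ∈ Finset.range K, μ.real (slab n (3 / 4 * (2 ^ k * a)) (5 / 4 * (2 ^ (k + 1) * a))) ≤
      3 * μ.real univ := by
  have ha2 : 0 < a / 2 := by positivity
  have hk : ∀ k ∈ Finset.range K,
      μ.real (slab n (3 / 4 * (2 ^ k * a)) (5 / 4 * (2 ^ (k + 1) * a))) ≤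
      μ.real {z : E | z ⊤ ∈ Ico (2 ^ (k + 0) * (a / 2)) (2 ^ (k + 0 + 1) * (a / 2))} +
      μ.real {z : E | z ⊤ ∈ Ico (2 ^ (k + 1) * (a / 2)) (2 ^ (k + 1 + 1) * (a / 2))} +
      μ.real {z : E | z ⊤ ∈ Ico (2 ^ (k + 2) * (a / 2)) (2 ^ (k + 2 + 1) * (a / 2))} := by
    intro k _
    refine le_trans (measureReal_mono ?_) ((measureReal_union_le _ _).trans
      (add_le_add_left (measureReal_union_le _ _) _))
    intro z hz
    have h1 := hz.1
    have h2 := hz.2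
    have hp : 0 < (2 : ℝ) ^ k * a := by positivity
    simp only [pow_succ, add_zero] at h1 h2 ⊢
    by_cases c1 : z ⊤ < 2 ^ k * a
    · left; left; constructor <;> linarith
    · by_cases c2 : z ⊤ < 2 * (2 ^ k * a)
      · left; right; constructor <;> linarith
      · right; constructor <;> linarith
  refine (Finset.sum_le_sum hk).trans ?_
  rw [Finset.sum_add_distrib, Finset.sum_add_distrib]
  linarith [sum_dyadicSlab_le μ ha2 0 K, sum_dyadicSlab_le μ ha2 1 K, sum_dyadicSlab_le μ ha2 2 K]

/-- Hölder's inequality for sums against the constant 1; the large-scale exponent 1 - 1/p originates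
here. -/
theorem sum_rpow_le {p : ℝ} (hp : 1 < p) (K : ℕ) {f : ℕ → ℝ} (hf : ∀ k, 0 ≤ f k) {A : ℝ}
    (hA : ∑ k ∈ Finset.range K, f k ≤ A) :
    ∑ k ∈ Finset.range K, f k ^ (1 / p) ≤ (K : ℝ) ^ (1 - 1 / p) * A ^ (1 / p) := by
  have hc : p.HolderConjugate (p.conjExponent) := Real.HolderConjugate.conjExponent hp
  have hq : 1 / p.conjExponent = 1 - 1 / p := by
    have := hc.inv_add_inv_eq_one
    rw [one_div, one_div]; linarith
  have hp0 : 0 < p := by linarith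
  have := Real.inner_le_Lp_mul_Lq_of_nonneg (Finset.range K) hc
    (f := fun k => f k ^ (1 / p)) (g := fun _ => 1)
    (fun k _ => Real.rpow_nonneg (hf k) _) (fun _ _ => zero_le_one)
  have e : ∀ k, (f k ^ (1 / p)) ^ p = f k := fun k => by
    rw [← Real.rpow_mul (hf k), one_div_mul_cancel hp0.ne', Real.rpow_one]
  simp only [e, mul_one, Real.one_rpow, Finset.sum_const, Finset.card_range, nsmul_eq_mul,
    hq] at this
  rw [mul_comm]
  refine this.trans ?_
  gcongr
  exact Finset.sum_nonneg fun k _ => hf k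

/-- The point above or below `x` at height `h`. -/
noncomputable def atHeight (x : E) (h : ℝ) : E := x + (h - x ⊤) • EuclideanSpace.single ⊤ 1

@[simp] theorem atHeight_last (x : E) (h : ℝ) : atHeight x h ⊤ = h := by
  simp [atHeight]

theorem dist_atHeight (x : E) (h h' : ℝ) : dist (atHeight x h) (atHeight x h') = |h - h'| := by
  rw [dist_eq_norm, atHeight, atHeight, add_sub_add_left_eq_sub, ← sub_smul, norm_smul]
  simp

theorem atHeight_self (x : E) : atHeight x (x ⊤) = x := by simp [atHeight]

theorem dist_atHeight_le (x y : E) (h : ℝ) : dist (atHeight x h) (atHeight y h) ≤ dist x y := by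
  rw [EuclideanSpace.dist_eq, EuclideanSpace.dist_eq]
  apply Real.sqrt_le_sqrt
  refine Finset.sum_le_sum fun i _ => ?_
  by_cases hi : i = ⊤
  · subst hi
    simp [dist_nonneg]
  · simp [atHeight, hi]

/-- Each doubling of the height costs the p-th root of the energy of one slab. The summand 1 absorbs
the last, incomplete doubling. -/
theorem exists_unitAvg_vertical_bound (p : ℝ) (hp : (n : ℝ) < p) :
    ∃ C : ℝ, 0 < C ∧ ∀ (u : E → ℝ) (Du : E → E →L[ℝ] ℝ), HasSobolevDeriv p u Du →
      ∀ (x : E) (h : ℝ), 0 < x ⊤ → x ⊤ ≤ h →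
        |unitAvg u (atHeight x h) - unitAvg u x| ≤
          C * (1 + 2 * Real.log (h / x ⊤)) ^ (1 - 1 / p) * hypNorm p Du := by
  obtain ⟨C, hC, hCb⟩ := exists_unitAvg_sub_bound (n := n) p hp
  have hn1 : (1 : ℝ) ≤ n := by exact_mod_cast NeZero.one_le
  have hp1 : 1 < p := hn1.trans_lt hp
  have hp0 : 0 < p := by linarith
  have hβ : 0 ≤ 1 - 1 / p := by rw [sub_nonneg, div_le_one hp0]; exact hp1.le
  refine ⟨C * (3 ^ (1 / p) + 1), by positivity, fun u Du hu x h hx hxh => ?_⟩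
  have := isFiniteMeasure_energyMeasure hu
  rw [hypNorm_eq hu]
  set μ := energyMeasure p Du
  set N := μ.real univ ^ (1 / p) with hN
  obtain ⟨K, hK1, hK2⟩ := exists_nat_pow_near ((one_le_div hx).2 hxh) one_lt_two
  rw [le_div_iff₀ hx] at hK1
  rw [div_lt_iff₀ hx] at hK2
  -- The factor 2 is an upper bound for 1 / log 2.
  have hlog : (K : ℝ) ≤ 2 * Real.log (h / x ⊤) := by
    have h1 : Real.log (2 ^ K) ≤ Real.log (h / x ⊤) :=
      Real.log_le_log (by positivity) ((le_div_iff₀ hx).2 hK1)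
    rw [Real.log_pow] at h1
    have h2 := Real.log_two_gt_d9
    have h3 : (0 : ℝ) ≤ K := Nat.cast_nonneg K
    nlinarith
  have hstep : ∀ k : ℕ, ∀ t : ℝ, 2 ^ k * x ⊤ ≤ t → t ≤ 2 ^ (k + 1) * x ⊤ →
      |unitAvg u (atHeight x t) - unitAvg u (atHeight x (2 ^ k * x ⊤))| ≤
        C * μ.real (slab n (3 / 4 * (2 ^ k * x ⊤)) (5 / 4 * (2 ^ (k + 1) * x ⊤))) ^ (1 / p) := by
    intro k t h1 h2
    have hpos : 0 < 2 ^ k * x ⊤ := by positivity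
    have hle : 2 ^ k * x ⊤ ≤ 2 ^ (k + 1) * x ⊤ := h1.trans h2
    refine (hCb u Du hu (atHeight x (2 ^ k * x ⊤)) (atHeight x t) (2 ^ k * x ⊤)
      (2 ^ (k + 1) * x ⊤) hpos (by simp [slab, hle]) (by simp [slab, h1, h2])).trans ?_
    gcongr
    refine mul_le_of_le_one_right hC.le ?_
    rw [dist_atHeight, div_le_one hpos, abs_sub_comm, abs_of_nonneg (by linarith)]
    rw [pow_succ] at h2
    linarith
  have hsum : |unitAvg u (atHeight x (2 ^ K * x ⊤)) - unitAvg u x| ≤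
      C * ((K : ℝ) ^ (1 - 1 / p) * (3 * μ.real univ) ^ (1 / p)) := by
    have e : unitAvg u (atHeight x (2 ^ K * x ⊤)) - unitAvg u x =
        ∑ k ∈ Finset.range K, (unitAvg u (atHeight x (2 ^ (k + 1) * x ⊤)) -
          unitAvg u (atHeight x (2 ^ k * x ⊤))) := by
      rw [Finset.sum_range_sub fun k => unitAvg u (atHeight x (2 ^ k * x ⊤))]
      simp [atHeight_self]
    rw [e]
    refine (Finset.abs_sum_le_sum_abs _ _).trans ?_
    refine (Finset.sum_le_sum fun k _ => hstep k (2 ^ (k + 1) * x ⊤) ?_ le_rfl).trans ?_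
    · have : (2 : ℝ) ^ k ≤ 2 ^ (k + 1) := pow_le_pow_right₀ one_le_two (by omega)
      gcongr
    · rw [← Finset.mul_sum]
      gcongr
      exact sum_rpow_le hp1 K (fun k => measureReal_nonneg) (sum_slab_le μ hx K)
  have hlast := hstep K h hK1 hK2.le
  have hl2 : μ.real (slab n (3 / 4 * (2 ^ K * x ⊤)) (5 / 4 * (2 ^ (K + 1) * x ⊤))) ^ (1 / p) ≤ N := by
    rw [hN]
    gcongr
    · exact measure_ne_top _ _
    · exact subset_univ _
  have hN0 : 0 ≤ N := by positivity
  have hL0 : 0 ≤ Real.log (h / x ⊤) := Real.log_nonneg ((one_le_div hx).2 hxh)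
  set Λ := (1 + 2 * Real.log (h / x ⊤)) ^ (1 - 1 / p)
  have hΛ1 : 1 ≤ Λ := Real.one_le_rpow (by linarith) hβ
  have hΛ2 : (K : ℝ) ^ (1 - 1 / p) ≤ Λ := by
    apply Real.rpow_le_rpow (Nat.cast_nonneg K) (by linarith) hβ
  calc |unitAvg u (atHeight x h) - unitAvg u x|
      ≤ |unitAvg u (atHeight x h) - unitAvg u (atHeight x (2 ^ K * x ⊤))| +
        |unitAvg u (atHeight x (2 ^ K * x ⊤)) - unitAvg u x| := abs_sub_le _ _ _
    _ ≤ C * N + C * ((K : ℝ) ^ (1 - 1 / p) * (3 * μ.real univ) ^ (1 / p)) :=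
        add_le_add (hlast.trans (by gcongr)) hsum
    _ ≤ C * (Λ * N) + C * (Λ * (3 ^ (1 / p) * N)) := by
        rw [Real.mul_rpow (by norm_num) measureReal_nonneg]
        gcongr
        exact le_mul_of_one_le_left hN0 hΛ1
    _ = _ := by ring

/-! ### Comparison with the hyperbolic distance, and the upper bound. -/

theorem hypDist_comm (x y : E) : hypDist x y = hypDist y x := by
  rw [hypDist, hypDist, dist_comm, mul_comm (x ⊤)]

theorem hypDist_nonneg (x y : E) : 0 ≤ hypDist x y := by
  have : 0 ≤ Real.arsinh (dist x y / (2 * √(x ⊤ * y ⊤))) := Real.arsinh_nonneg_iff.2 (by positivity)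
  rw [hypDist]; positivity

theorem half_le_arsinh {s : ℝ} (h0 : 0 ≤ s) (h1 : s ≤ 1) : s / 2 ≤ Real.arsinh s := by
  rw [← Real.arsinh_sinh (s / 2), Real.arsinh_le_arsinh, Real.sinh_eq]
  have h2 : Real.exp (s / 2) ≤ 1 + s / 2 + (s / 2) ^ 2 := by
    have := Real.abs_exp_sub_one_sub_id_le (x := s / 2) (by rw [abs_of_nonneg] <;> linarith)
    linarith [(abs_le.1 this).2]
  have h3 : 1 + -(s / 2) ≤ Real.exp (-(s / 2)) := by linarith [Real.add_one_le_exp (-(s / 2))]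
  nlinarith

theorem log_two_mul_le_arsinh {s : ℝ} (h0 : 0 < s) : Real.log (2 * s) ≤ Real.arsinh s := by
  rw [Real.arsinh]
  apply Real.log_le_log (by positivity)
  have : s ≤ √(1 + s ^ 2) := Real.le_sqrt_of_sq_le (by linarith)
  linarith

/-- Measured from the higher point, √(xₙyₙ) ≤ xₙ. The restriction t ≤ 2 keeps the argument t/2 in
the range where `arsinh` is bounded below linearly. -/
theorem div_le_hypDist {x y : E} (hx : 0 < x ⊤) (hy : 0 < y ⊤) (hyx : y ⊤ ≤ x ⊤) {t : ℝ}
    (ht0 : 0 ≤ t) (ht : t ≤ 2) (h : t * x ⊤ ≤ dist x y) : t / 2 ≤ hypDist x y := by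
  have hs : √(x ⊤ * y ⊤) ≤ x ⊤ := by
    rw [Real.sqrt_le_left hx.le]; nlinarith
  have hpos : 0 < √(x ⊤ * y ⊤) := by positivity
  have h1 : t / 2 ≤ dist x y / (2 * √(x ⊤ * y ⊤)) := by
    rw [div_le_div_iff₀ (by norm_num) (by positivity)]
    nlinarith
  have h2 := half_le_arsinh (s := t / 2) (by linarith) (by linarith)
  have h3 := Real.arsinh_le_arsinh.2 h1
  rw [hypDist]
  linarith

/-- The estimate for close points. -/
theorem exists_sub_bound_of_near (p : ℝ) (hp : (n : ℝ) < p) :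
    ∃ C : ℝ, 0 < C ∧ ∀ (u : E → ℝ) (Du : E → E →L[ℝ] ℝ), HasSobolevDeriv p u Du →
      ∀ᵐ z ∂(hypVolume n).prod (hypVolume n), z.2 ⊤ ≤ z.1 ⊤ → dist z.1 z.2 ≤ z.1 ⊤ / 4 →
        |u z.1 - u z.2| ≤ C * hypDist z.1 z.2 ^ (1 - n / p) * hypNorm p Du := by
  obtain ⟨C₁, hC₁, h₁⟩ := exists_ae_sub_smoothAvg_bound (n := n) p hp
  obtain ⟨C₂, hC₂, h₂⟩ := exists_smoothAvg_translate_bound (n := n) p hp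
  have hp0 : 0 < p := (Nat.cast_nonneg n).trans_lt hp
  set α := 1 - (n : ℝ) / p with hα
  have hα0 : 0 < α := by rw [hα, sub_pos, div_lt_one hp0]; exact hp
  refine ⟨(C₁ * 3 ^ α + C₂ * 2 ^ α + C₁ * 3 ^ α), by positivity, fun u Du hu => ?_⟩
  have hN : 0 ≤ hypNorm p Du := by rw [hypNorm_eq hu]; positivity
  have hae : ∀ᵐ x ∂hypVolume n, x ∈ halfSpace n ∧ ∀ r : ℝ, 0 < r → r ≤ x ⊤ / 2 →
      |smoothAvg u x r - u x| ≤ C₁ * (r / x ⊤) ^ α * hypNorm p Du := by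
    filter_upwards [ae_hypVolume_mem_halfSpace n, (hypVolume_absolutelyContinuous n).ae_le
      (ae_restrict_of_ae (h₁ u Du hu))] with x hx1 hx2 using ⟨hx1, hx2 hx1⟩
  filter_upwards [Measure.quasiMeasurePreserving_fst.ae hae,
    Measure.quasiMeasurePreserving_snd.ae hae] with z hz1 hz2 hle hd
  obtain ⟨x, y⟩ := z
  obtain ⟨hx, hx'⟩ := hz1
  obtain ⟨hy, hy'⟩ := hz2
  simp only at *
  have hx0 : 0 < x ⊤ := hx
  have hy0 : 0 < y ⊤ := hy
  rcases eq_or_ne x y with rfl | hxy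
  · simp only [sub_self, abs_zero]
    have := hypDist_nonneg x x
    positivity
  have hr : 0 < dist x y := dist_pos.2 hxy
  -- Comparable heights make the radius `dist x y` admissible at both points.
  have hyx : 3 / 4 * x ⊤ ≤ y ⊤ := by
    have := (abs_le.1 ((abs_coord_sub_le x y).trans hd)).2
    linarith
  have a1 := hx' (dist x y) hr (by linarith)
  have a2 := hy' (dist x y) hr (by linarith)
  have a3 := h₂ u Du hu x y hr hd
  have hdd : dist x y / x ⊤ ≤ 2 * hypDist x y := by
    have := div_le_hypDist hx0 hy0 hle (t := dist x y / x ⊤) (by positivity)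
      (by rw [div_le_iff₀ hx0]; linarith) (by rw [div_mul_cancel₀ _ hx0.ne'])
    linarith
  have hdy : dist x y / y ⊤ ≤ 3 * hypDist x y := by
    have : dist x y / y ⊤ ≤ dist x y / (3 / 4 * x ⊤) := by gcongr
    have h2 : dist x y / (3 / 4 * x ⊤) = 4 / 3 * (dist x y / x ⊤) := by field_simp
    linarith [hypDist_nonneg x y]
  have hd0 := hypDist_nonneg x y
  have b1 : (dist x y / x ⊤) ^ α ≤ 3 ^ α * hypDist x y ^ α := by
    rw [← Real.mul_rpow (by norm_num) hd0]
    exact Real.rpow_le_rpow (by positivity) (by linarith) hα0.le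
  have b2 : (dist x y / y ⊤) ^ α ≤ 3 ^ α * hypDist x y ^ α := by
    rw [← Real.mul_rpow (by norm_num) hd0]
    exact Real.rpow_le_rpow (by positivity) hdy hα0.le
  have b3 : (dist x y / x ⊤) ^ α ≤ 2 ^ α * hypDist x y ^ α := by
    rw [← Real.mul_rpow (by norm_num) hd0]
    exact Real.rpow_le_rpow (by positivity) hdd hα0.le
  calc |u x - u y| = |-(smoothAvg u x (dist x y) - u x) +
        -(smoothAvg u y (dist x y) - smoothAvg u x (dist x y)) +
        (smoothAvg u y (dist x y) - u y)| := by congr 1; ring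
    _ ≤ |smoothAvg u x (dist x y) - u x| +
        |smoothAvg u y (dist x y) - smoothAvg u x (dist x y)| +
        |smoothAvg u y (dist x y) - u y| := by
      refine (abs_add_three _ _ _).trans ?_
      rw [abs_neg, abs_neg]
    _ ≤ C₁ * (3 ^ α * hypDist x y ^ α) * hypNorm p Du +
        C₂ * (2 ^ α * hypDist x y ^ α) * hypNorm p Du +
        C₁ * (3 ^ α * hypDist x y ^ α) * hypNorm p Du := by
      refine add_le_add (add_le_add (a1.trans ?_) (a3.trans ?_)) (a2.trans ?_) <;> gcongr
    _ = _ := by ring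

/-- The logarithms of 4|x - y|/xₙ and 4|x - y|/yₙ add up to at most 2 log 4 + d. The first is
nonnegative, so the second obeys the same bound; additive constants are absorbed by d ≥ 1/8. -/
theorem log_le_hypDist {x y : E} (hx : 0 < x ⊤) (hy : 0 < y ⊤) (hyx : y ⊤ ≤ x ⊤)
    (h : x ⊤ / 4 < dist x y) :
    1 + 2 * Real.log (4 * dist x y / y ⊤) ≤ 60 * hypDist x y := by
  have hd : 0 < dist x y := by linarith
  have hlow : 1 / 8 ≤ hypDist x y := by
    have := div_le_hypDist hx hy hyx (t := 1 / 4) (by norm_num) (by norm_num) (by linarith)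
    linarith
  have hpos : 0 < √(x ⊤ * y ⊤) := by positivity
  have h1 : 0 ≤ Real.log (4 * dist x y / x ⊤) := by
    apply Real.log_nonneg
    rw [one_le_div hx]
    linarith
  have h2 : 2 * Real.log (dist x y / √(x ⊤ * y ⊤)) ≤ hypDist x y := by
    have := log_two_mul_le_arsinh (s := dist x y / (2 * √(x ⊤ * y ⊤))) (by positivity)
    rw [show 2 * (dist x y / (2 * √(x ⊤ * y ⊤))) = dist x y / √(x ⊤ * y ⊤) by field_simp] at this
    rw [hypDist]
    linarith
  have h3 : Real.log (4 * dist x y / x ⊤) + Real.log (4 * dist x y / y ⊤) =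
      2 * Real.log 4 + 2 * Real.log (dist x y / √(x ⊤ * y ⊤)) := by
    rw [Real.log_div (by positivity) hx.ne', Real.log_div (by positivity) hy.ne',
      Real.log_div hd.ne' hpos.ne', Real.log_sqrt (by positivity), Real.log_mul hx.ne' hy.ne',
      Real.log_mul (by norm_num) hd.ne']
    ring
  have h4 : Real.log 4 ≤ 1.4 := by
    rw [show (4 : ℝ) = 2 ^ 2 by norm_num, Real.log_pow]
    have := Real.log_two_lt_d9
    push_cast
    linarith
  linarith

/-- The estimate for distant points. -/
theorem exists_sub_bound_of_far (p : ℝ) (hp : (n : ℝ) < p) :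
    ∃ C : ℝ, 0 < C ∧ ∀ (u : E → ℝ) (Du : E → E →L[ℝ] ℝ), HasSobolevDeriv p u Du →
      ∀ᵐ z ∂(hypVolume n).prod (hypVolume n), z.2 ⊤ ≤ z.1 ⊤ → z.1 ⊤ / 4 < dist z.1 z.2 →
        |u z.1 - u z.2| ≤ C * hypDist z.1 z.2 ^ (1 - 1 / p) * hypNorm p Du := by
  obtain ⟨C₁, hC₁, h₁⟩ := exists_ae_sub_smoothAvg_bound (n := n) p hp
  obtain ⟨C₂, hC₂, h₂⟩ := exists_unitAvg_vertical_bound (n := n) p hp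
  obtain ⟨C₃, hC₃, h₃⟩ := exists_unitAvg_sub_bound (n := n) p hp
  have hn1 : (1 : ℝ) ≤ n := by exact_mod_cast NeZero.one_le
  have hp1 : 1 < p := hn1.trans_lt hp
  have hp0 : 0 < p := by linarith
  have hα0 : 0 < 1 - (n : ℝ) / p := by rw [sub_pos, div_lt_one hp0]; exact hp
  have hβ : 0 ≤ 1 - 1 / p := by rw [sub_nonneg, div_le_one hp0]; exact hp1.le
  refine ⟨(2 * C₁ + 2 * C₂ + C₃) * 60 ^ (1 - 1 / p), by positivity, fun u Du hu => ?_⟩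
  have := isFiniteMeasure_energyMeasure hu
  have hN : 0 ≤ hypNorm p Du := by rw [hypNorm_eq hu]; positivity
  have hae : ∀ᵐ x ∂hypVolume n, x ∈ halfSpace n ∧
      |unitAvg u x - u x| ≤ C₁ * hypNorm p Du := by
    filter_upwards [ae_hypVolume_mem_halfSpace n, (hypVolume_absolutelyContinuous n).ae_le
      (ae_restrict_of_ae (h₁ u Du hu))] with x hx1 hx2
    have hx0 : 0 < x ⊤ := hx1
    refine ⟨hx1, (hx2 hx1 (x ⊤ / 4) (by positivity) (by linarith)).trans ?_⟩
    gcongr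
    refine mul_le_of_le_one_right hC₁.le (Real.rpow_le_one (by positivity) ?_ hα0.le)
    rw [div_le_one hx0]; linarith
  filter_upwards [Measure.quasiMeasurePreserving_fst.ae hae,
    Measure.quasiMeasurePreserving_snd.ae hae] with z hz1 hz2 hle hd
  obtain ⟨x, y⟩ := z
  obtain ⟨hx, a1⟩ := hz1
  obtain ⟨hy, a2⟩ := hz2
  simp only at *
  have hx0 : 0 < x ⊤ := hx
  have hy0 : 0 < y ⊤ := hy
  -- This height is above both points, and at this height the horizontal gap is less than h, so the
  -- crossing costs only a constant.
  set h := 4 * dist x y with hh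
  have hh0 : 0 < h := by linarith
  have a3 := h₂ u Du hu x h hx0 (by linarith)
  have a4 := h₂ u Du hu y h hy0 (by linarith)
  have a5 : |unitAvg u (atHeight y h) - unitAvg u (atHeight x h)| ≤ C₃ * hypNorm p Du := by
    refine (h₃ u Du hu (atHeight x h) (atHeight y h) h h hh0 (by simp [slab])
      (by simp [slab])).trans ?_
    rw [hypNorm_eq hu]
    gcongr
    · refine mul_le_of_le_one_right hC₃.le ?_
      rw [div_le_one hh0]
      have := dist_atHeight_le x y h
      linarith
    · exact measure_ne_top _ _
    · exact subset_univ _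
  have hlx : Real.log (h / x ⊤) ≤ Real.log (h / y ⊤) := by
    apply Real.log_le_log (by positivity)
    gcongr
  have hl0 : 0 ≤ Real.log (h / x ⊤) := by
    apply Real.log_nonneg
    rw [one_le_div hx0]
    linarith
  have hdist := log_le_hypDist hx0 hy0 hle hd
  have hd0 := hypDist_nonneg x y
  set Λ := (60 : ℝ) ^ (1 - 1 / p) * hypDist x y ^ (1 - 1 / p) with hΛ
  have hΛ' : Λ = (60 * hypDist x y) ^ (1 - 1 / p) := by rw [Real.mul_rpow (by norm_num) hd0]
  have hΛ1 : 1 ≤ Λ := by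
    rw [hΛ']
    exact Real.one_le_rpow (by linarith) hβ
  have b3 : (1 + 2 * Real.log (h / x ⊤)) ^ (1 - 1 / p) ≤ Λ := by
    rw [hΛ']
    exact Real.rpow_le_rpow (by linarith) (by linarith) hβ
  have b4 : (1 + 2 * Real.log (h / y ⊤)) ^ (1 - 1 / p) ≤ Λ := by
    rw [hΛ']
    exact Real.rpow_le_rpow (by linarith) (by linarith) hβ
  have c : ∀ C : ℝ, 0 < C → C * hypNorm p Du ≤ C * Λ * hypNorm p Du := fun C hC => by
    gcongr
    exact le_mul_of_one_le_right hC.le hΛ1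
  have t1 := abs_sub_le (u x) (unitAvg u x) (u y)
  have t2 := abs_sub_le (unitAvg u x) (unitAvg u (atHeight x h)) (u y)
  have t3 := abs_sub_le (unitAvg u (atHeight x h)) (unitAvg u (atHeight y h)) (u y)
  have t4 := abs_sub_le (unitAvg u (atHeight y h)) (unitAvg u y) (u y)
  rw [abs_sub_comm (u x) (unitAvg u x)] at t1
  rw [abs_sub_comm (unitAvg u x) (unitAvg u (atHeight x h))] at t2
  rw [abs_sub_comm (unitAvg u (atHeight x h)) (unitAvg u (atHeight y h))] at t3
  have b3' : C₂ * (1 + 2 * Real.log (h / x ⊤)) ^ (1 - 1 / p) * hypNorm p Du ≤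
    C₂ * Λ * hypNorm p Du := by gcongr
  have b4' : C₂ * (1 + 2 * Real.log (h / y ⊤)) ^ (1 - 1 / p) * hypNorm p Du ≤
    C₂ * Λ * hypNorm p Du := by gcongr
  have c1 := c C₁ hC₁
  have c3 := c C₃ hC₃
  calc |u x - u y| ≤ 2 * (C₁ * Λ * hypNorm p Du) + 2 * (C₂ * Λ * hypNorm p Du) +
        C₃ * Λ * hypNorm p Du := by linarith
    _ = _ := by rw [hΛ]; ring

theorem exists_sobolev_morrey_bound (p : ℝ) (hp : (n : ℝ) < p) :
    ∃ C : ℝ, 0 < C ∧ ∀ (u : E → ℝ) (Du : E → E →L[ℝ] ℝ), HasSobolevDeriv p u Du →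
      ∀ᵐ z ∂(hypVolume n).prod (hypVolume n), |u z.1 - u z.2| ≤
        C * max (hypDist z.1 z.2 ^ (1 - n / p)) (hypDist z.1 z.2 ^ (1 - 1 / p)) *
          hypNorm p Du := by
  obtain ⟨C₁, hC₁, h₁⟩ := exists_sub_bound_of_near (n := n) p hp
  obtain ⟨C₂, hC₂, h₂⟩ := exists_sub_bound_of_far (n := n) p hp
  refine ⟨max C₁ C₂, by positivity, fun u Du hu => ?_⟩
  have hN : 0 ≤ hypNorm p Du := by rw [hypNorm_eq hu]; positivity
  have key : ∀ᵐ z ∂(hypVolume n).prod (hypVolume n), z.2 ⊤ ≤ z.1 ⊤ → |u z.1 - u z.2| ≤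
      max C₁ C₂ * max (hypDist z.1 z.2 ^ (1 - n / p)) (hypDist z.1 z.2 ^ (1 - 1 / p)) *
        hypNorm p Du := by
    filter_upwards [h₁ u Du hu, h₂ u Du hu] with z hz1 hz2 hle
    have hd0 := hypDist_nonneg z.1 z.2
    rcases le_or_gt (dist z.1 z.2) (z.1 ⊤ / 4) with h | h
    · refine (hz1 hle h).trans ?_
      gcongr
      · exact le_max_left _ _
      · exact le_max_left _ _
    · refine (hz2 hle h).trans ?_
      gcongr
      · exact le_max_right _ _
      · exact le_max_right _ _
  have : SFinite (hypVolume n) := by unfold hypVolume; infer_instance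
  -- Both regimes were treated with the first point the higher one; exchanging the factors preserves
  -- null sets.
  have hswap := (Measure.measurePreserving_swap (μ := hypVolume n)
    (ν := hypVolume n)).quasiMeasurePreserving.ae key
  filter_upwards [key, hswap] with z hz1 hz2
  rcases le_total (z.2 ⊤) (z.1 ⊤) with h | h
  · exact hz1 h
  · have := hz2 h
    simp only [Prod.fst_swap, Prod.snd_swap] at this
    rwa [abs_sub_comm, hypDist_comm] at this

/-! ### Test functions for sharpness. -/

theorem hasWeakDeriv_of_contDiff {u : E → ℝ} (hu : ContDiff ℝ ∞ u) :
    HasWeakDeriv u (fderiv ℝ u) := by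
  have hcd : Continuous (fderiv ℝ u) := hu.continuous_fderiv (by simp)
  refine ⟨hu.continuous.locallyIntegrable.locallyIntegrableOn _,
    hcd.locallyIntegrable.locallyIntegrableOn _, fun φ hφ hφc hφs v => ?_⟩
  have hφd : Continuous (fderiv ℝ φ) := hφ.continuous_fderiv (by simp)
  have h0 : ∀ z, z ∉ halfSpace n → φ z = 0 := fun z hz =>
    image_eq_zero_of_notMem_tsupport fun h => hz (hφs h)
  have h1 : ∀ z, z ∉ halfSpace n → fderiv ℝ φ z = 0 := fun z hz => by
    by_contra h
    exact hz (hφs (support_fderiv_subset ℝ (Function.mem_support.2 h)))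
  rw [setIntegral_eq_integral_of_forall_compl_eq_zero fun z hz => by simp [h1 z hz],
    setIntegral_eq_integral_of_forall_compl_eq_zero fun z hz => by simp [h0 z hz]]
  apply integral_mul_fderiv_eq_neg_fderiv_mul_of_integrable
  · exact ((hcd.clm_apply continuous_const).mul hφ.continuous).integrable_of_hasCompactSupport
      hφc.mul_left
  · exact (hu.continuous.mul (hφd.clm_apply continuous_const)).integrable_of_hasCompactSupport
      (hφc.fderiv_apply ℝ v).mul_left
  · exact (hu.continuous.mul hφ.continuous).integrable_of_hasCompactSupport hφc.mul_left
  · exact fun z _ => hu.differentiable (by simp) z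
  · exact fun z _ => hφ.differentiable (by simp) z

/-- In Lebesgue terms the energy density is zₙ^(p-n) |Du|^p. The majorant g lives on the whole
space, so integrals over full balls and annuli can be used. -/
theorem hasSobolevDeriv_of_contDiff {p : ℝ} (hp : 0 < p) {u : E → ℝ} (hu : ContDiff ℝ ∞ u)
    {g : E → ℝ} (hg : Integrable g) (hg0 : ∀ z, 0 ≤ g z)
    (hb : ∀ z ∈ halfSpace n, z ⊤ ^ (p - n) * ‖fderiv ℝ u z‖ ^ p ≤ g z) :
    HasSobolevDeriv p u (fderiv ℝ u) ∧ hypNorm p (fderiv ℝ u) ≤ (∫ z, g z) ^ (1 / p) := by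
  have hcd : Continuous (fderiv ℝ u) := hu.continuous_fderiv (by simp)
  have hlt : ∫⁻ z, ENNReal.ofReal (hypConorm z (fderiv ℝ u z) ^ p) ∂hypVolume n ≤
      ENNReal.ofReal (∫ z, g z) := by
    rw [← Measure.restrict_eq_self_of_ae_mem (ae_hypVolume_mem_halfSpace n),
      setLIntegral_hypVolume (measurableSet_halfSpace n) Subset.rfl,
      ofReal_integral_eq_lintegral_ofReal hg (Eventually.of_forall hg0)]
    refine le_trans (setLIntegral_mono' (measurableSet_halfSpace n) fun z hz => ?_)
      (setLIntegral_le_lintegral _ _)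
    have hz0 : 0 < z ⊤ := hz
    rw [← ENNReal.ofReal_mul (by positivity)]
    refine ENNReal.ofReal_le_ofReal (le_trans (le_of_eq ?_) (hb z hz))
    rw [hypConorm, Real.mul_rpow hz0.le (norm_nonneg _), Real.rpow_sub hz0, Real.rpow_natCast]
    ring
  have hs : HasSobolevDeriv p u (fderiv ℝ u) := by
    refine ⟨hasWeakDeriv_of_contDiff hu, ?_, ?_⟩
    · refine Measurable.aestronglyMeasurable ?_
      unfold hypConorm
      have h1 : Measurable fun z : E => z ⊤ * ‖fderiv ℝ u z‖ :=
        (continuous_lastCoord.mul hcd.norm).measurable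
      exact h1.pow_const p
    · have : (fun z => ‖hypConorm z (fderiv ℝ u z) ^ p‖ₑ) =ᵐ[hypVolume n]
          fun z => ENNReal.ofReal (hypConorm z (fderiv ℝ u z) ^ p) := by
        filter_upwards [ae_hypVolume_mem_halfSpace n] with z hz
        exact Real.enorm_of_nonneg (Real.rpow_nonneg (hypConorm_nonneg hz _) _)
      rw [HasFiniteIntegral, lintegral_congr_ae this]
      exact hlt.trans_lt ENNReal.ofReal_lt_top
  refine ⟨hs, ?_⟩
  rw [hypNorm_eq hs]
  refine Real.rpow_le_rpow measureReal_nonneg ?_ (by positivity)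
  rw [measureReal_def, energyMeasure, withDensity_apply _ MeasurableSet.univ, setLIntegral_univ]
  exact ENNReal.toReal_le_of_le_ofReal (integral_nonneg hg0) hlt

variable (n) in
/-- The point at height `exp s` on the vertical geodesic through the origin. -/
noncomputable def vertical (s : ℝ) : E := Real.exp s • EuclideanSpace.single ⊤ 1

@[simp] theorem vertical_last (s : ℝ) : vertical n s ⊤ = Real.exp s := by simp [vertical]

theorem norm_vertical (s : ℝ) : ‖vertical n s‖ = Real.exp s := by
  simp [vertical, norm_smul, abs_of_pos (Real.exp_pos s)]

theorem dist_vertical {s t : ℝ} (h : t ≤ s) :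
    dist (vertical n s) (vertical n t) = Real.exp s - Real.exp t := by
  rw [dist_eq_norm, vertical, vertical, ← sub_smul, norm_smul, Real.norm_of_nonneg
    (sub_nonneg.2 (Real.exp_le_exp.2 h))]
  simp

theorem hypDist_vertical {s t : ℝ} (h : t ≤ s) :
    hypDist (vertical n s) (vertical n t) = s - t := by
  rw [hypDist, dist_vertical h, vertical_last, vertical_last, ← Real.exp_add,
    ← Real.exp_half]
  have : (Real.exp s - Real.exp t) / (2 * Real.exp ((s + t) / 2)) = Real.sinh ((s - t) / 2) := by
    rw [Real.sinh_eq, div_eq_div_iff (by positivity) (by norm_num)]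
    have h1 : Real.exp s = Real.exp ((s - t) / 2) * Real.exp ((s + t) / 2) := by
      rw [← Real.exp_add]; ring_nf
    have h2 : Real.exp t = Real.exp (-((s - t) / 2)) * Real.exp ((s + t) / 2) := by
      rw [← Real.exp_add]; ring_nf
    rw [h1, h2]
    ring
  rw [this, Real.arsinh_sinh]
  ring

/-- At distances at most one, bump functions are almost extremal. -/
theorem exists_bump (p : ℝ) (hp : (n : ℝ) < p) :
    ∃ B : ℝ, 0 < B ∧ ∀ t : ℝ, 0 < t → t ≤ 1 → ∃ (u : E → ℝ) (Du : E → E →L[ℝ] ℝ),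
      HasSobolevDeriv p u Du ∧ hypNorm p Du ≤ B * t ^ (-(1 - n / p)) ∧
      ∀ᶠ z in 𝓝 (vertical n (t / 2), vertical n (-(t / 2))), 1 ≤ |u z.1 - u z.2| := by
  have hp0 : 0 < p := (Nat.cast_nonneg n).trans_lt hp
  set b : ContDiffBump (0 : E) := ⟨1 / 4, 1 / 2, by norm_num, by norm_num⟩ with hbdef
  have hbs : ContDiff ℝ ∞ (b : E → ℝ) := b.contDiff
  obtain ⟨K, hK⟩ := (b.hasCompactSupport.fderiv ℝ).exists_bound_of_continuous
    (hbs.continuous_fderiv (by simp))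
  have hK0 : 0 ≤ K := (norm_nonneg _).trans (hK 0)
  set κ : ℝ := (volume : Measure E).real (ball 0 1) with hκ
  -- Height at most 3, gradient at most (K + 1)/t and volume κ t^n give energy of order t^(n-p).
  -- Taking K + 1 ensures positivity.
  set B := (3 ^ (p - n) * (K + 1) ^ p * κ) ^ (1 / p) with hB
  have hκ0 : 0 < κ := ENNReal.toReal_pos (measure_ball_pos _ _ one_pos).ne' measure_ball_lt_top.ne
  refine ⟨B, by positivity, fun t ht0 ht1 => ?_⟩
  set x₀ := vertical n (t / 2)
  set y₀ := vertical n (-(t / 2))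
  set u : E → ℝ := fun z => b (t⁻¹ • (z - x₀)) with hu
  have hus : ContDiff ℝ ∞ u := by
    rw [hu]
    fun_prop
  have hfd : ∀ z, fderiv ℝ u z = t⁻¹ • fderiv ℝ b (t⁻¹ • (z - x₀)) := fun z => by
    have hd : HasFDerivAt b (fderiv ℝ b (t⁻¹ • (z - x₀))) (t⁻¹ • (z - x₀)) :=
      (hbs.differentiable (by simp) _).hasFDerivAt
    have := hd.comp z (((hasFDerivAt_id z).sub_const x₀).const_smul t⁻¹)
    rw [HasFDerivAt.fderiv (f := u) this]
    ext v
    simp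
  have hfd0 : ∀ z, z ∉ closedBall x₀ t → fderiv ℝ u z = 0 := fun z hz => by
    rw [hfd]
    have : fderiv ℝ b (t⁻¹ • (z - x₀)) = 0 := by
      by_contra h
      have h1 := support_fderiv_subset ℝ (f := (b : E → ℝ)) (Function.mem_support.2 h)
      rw [b.tsupport_eq, mem_closedBall_zero_iff, norm_smul, norm_inv, Real.norm_of_nonneg ht0.le,
        ← dist_eq_norm, inv_mul_eq_div, div_le_iff₀ ht0] at h1
      apply hz
      rw [mem_closedBall]
      change dist z x₀ ≤ 1 / 2 * t at h1
      linarith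
    rw [this, smul_zero]
  have hexp : Real.exp (t / 2) ≤ 2 := by
    have h1 : Real.exp (t / 2) ≤ Real.exp (1 / 2) := Real.exp_le_exp.2 (by linarith)
    have h2 : Real.exp (1 / 2) ≤ 1 / (1 - 1 / 2) :=
      Real.exp_bound_div_one_sub_of_interval (by norm_num) (by norm_num)
    linarith
  set g : E → ℝ := (closedBall x₀ t).indicator fun _ => 3 ^ (p - n) * (t⁻¹ * (K + 1)) ^ p with hg
  have hBm : MeasurableSet (closedBall x₀ t) := isClosed_closedBall.measurableSet
  obtain ⟨h1, h2⟩ := hasSobolevDeriv_of_contDiff (g := g) hp0 hus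
    ((integrable_indicator_iff hBm).2 (integrableOn_const measure_closedBall_lt_top.ne))
    (fun z => indicator_nonneg (fun _ _ => by positivity) z) (fun z hz => by
      have hz0 : 0 < z ⊤ := hz
      by_cases hzB : z ∈ closedBall x₀ t
      · rw [hg, indicator_of_mem hzB]
        have hz3 : z ⊤ ≤ 3 := by
          have := (coord_bounds_of_mem_closedBall hzB).2
          rw [vertical_last] at this
          linarith
        have hn : ‖fderiv ℝ u z‖ ≤ t⁻¹ * (K + 1) := by
          rw [hfd, norm_smul, Real.norm_of_nonneg (by positivity)]
          gcongr
          exact (hK _).trans (by linarith)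
        have : 0 ≤ p - n := by linarith
        gcongr
      · rw [hfd0 z hzB, norm_zero, Real.zero_rpow hp0.ne', mul_zero]
        exact indicator_nonneg (fun _ _ => by positivity) z)
  refine ⟨u, _, h1, h2.trans (le_of_eq ?_), ?_⟩
  · have hv : volume.real (closedBall x₀ t) = t ^ n * κ := by
      rw [measureReal_def, Measure.addHaar_closedBall _ _ ht0.le, finrank_euclideanSpace_fin,
        ENNReal.toReal_mul, ENNReal.toReal_ofReal (by positivity)]
      rfl
    have e : ∫ z, g z = (3 ^ (p - n) * (K + 1) ^ p * κ) * t ^ ((n : ℝ) - p) := by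
      rw [hg, integral_indicator hBm, setIntegral_const, hv,
        Real.mul_rpow (by positivity) (by positivity), Real.inv_rpow ht0.le, Real.rpow_sub ht0,
        Real.rpow_natCast, smul_eq_mul]
      field_simp
    rw [e, Real.mul_rpow (by positivity) (by positivity), ← Real.rpow_mul ht0.le]
    congr 2
    field_simp
    ring
  · have e1 : ∀ᶠ z : E × E in 𝓝 (x₀, y₀), z.1 ∈ ball x₀ (t / 4) :=
      continuousAt_fst.eventually (ball_mem_nhds _ (by positivity))
    -- The Euclidean gap is 2 sinh(t/2) ≥ t, so y₀ lies well outside the bump, whose radius is t/2.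
    have hxy : t ≤ dist y₀ x₀ := by
      rw [dist_comm, dist_vertical (by linarith)]
      linarith [Real.add_one_le_exp (t / 2), Real.exp_bound_div_one_sub_of_interval
        (x := t / 2) (by linarith) (by linarith), Real.sinh_eq (t / 2),
        Real.self_le_sinh_iff.2 (by linarith : 0 ≤ t / 2)]
    have e2 : ∀ᶠ z : E × E in 𝓝 (x₀, y₀), t / 2 < dist z.2 x₀ :=
      (continuous_snd.dist continuous_const).continuousAt.eventually
        (lt_mem_nhds (by simp only; linarith))
    filter_upwards [e1, e2] with z hz1 hz2
    have u1 : u z.1 = 1 := by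
      apply b.one_of_mem_closedBall
      rw [mem_closedBall_zero_iff, norm_smul, norm_inv, Real.norm_of_nonneg ht0.le,
        ← dist_eq_norm, inv_mul_eq_div, div_le_iff₀ ht0]
      have := mem_ball.1 hz1
      change dist z.1 x₀ ≤ 1 / 4 * t
      linarith
    have u2 : u z.2 = 0 := by
      apply b.zero_of_le_dist
      rw [dist_zero_right, norm_smul, norm_inv, Real.norm_of_nonneg ht0.le,
        ← dist_eq_norm, inv_mul_eq_div, le_div_iff₀ ht0]
      change 1 / 2 * t ≤ dist z.2 x₀
      linarith
    rw [u1, u2]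
    simp

theorem exists_smoothTransition_deriv_bound :
    ∃ K : ℝ, 0 < K ∧ (∀ s, |deriv Real.smoothTransition s| ≤ K) ∧
      ∀ s, s ∉ Icc (0 : ℝ) 1 → deriv Real.smoothTransition s = 0 := by
  have hz : ∀ s, s ∉ Icc (0 : ℝ) 1 → deriv Real.smoothTransition s = 0 := by
    intro s hs
    rw [mem_Icc, not_and_or, not_le, not_le] at hs
    rcases hs with hs | hs
    · have : Real.smoothTransition =ᶠ[𝓝 s] fun _ => 0 := by
        filter_upwards [Iio_mem_nhds hs] with r hr using
          Real.smoothTransition.zero_of_nonpos (le_of_lt hr)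
      rw [this.deriv_eq, deriv_const]
    · have : Real.smoothTransition =ᶠ[𝓝 s] fun _ => 1 := by
        filter_upwards [Ioi_mem_nhds hs] with r hr using
          Real.smoothTransition.one_of_one_le (le_of_lt hr)
      rw [this.deriv_eq, deriv_const]
  have hc : Continuous (deriv Real.smoothTransition) :=
    (Real.smoothTransition.contDiff (n := 1)).continuous_deriv (by simp)
  obtain ⟨K, hK⟩ := isCompact_Icc.exists_bound_of_continuousOn (s := Icc (0 : ℝ) 1) hc.continuousOn
  refine ⟨|K| + 1, by positivity, fun s => ?_, hz⟩
  by_cases hs : s ∈ Icc (0 : ℝ) 1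
  · exact (hK s hs).trans (by linarith [le_abs_self K])
  · rw [hz s hs, abs_zero]; positivity

variable (n) in
-- In polar coordinates r^(n-1) · r^(-n) = 1/r: the density is scale invariant, so an annulus
-- contributes only the logarithm of its ratio of radii.
theorem integral_indicator_norm_rpow {a b : ℝ} (ha : 0 < a) (hab : a ≤ b) :
    Integrable (fun z : E => (Icc a b).indicator (fun r => (r ^ n)⁻¹) ‖z‖) ∧
    ∫ z : E, (Icc a b).indicator (fun r => (r ^ n)⁻¹) ‖z‖ =
      n * (volume : Measure E).real (ball 0 1) * Real.log (b / a) := by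
  have hsub : Icc a b ⊆ Ioi 0 := fun r hr => ha.trans_le hr.1
  have e : EqOn (fun y : ℝ => y ^ (Module.finrank ℝ E - 1) • (Icc a b).indicator
      (fun r => (r ^ n)⁻¹) y) ((Icc a b).indicator fun y => y⁻¹) (Ioi 0) := by
    intro y hy
    have hy0 : (0 : ℝ) < y := hy
    by_cases hyI : y ∈ Icc a b
    · simp only [indicator_of_mem hyI, finrank_euclideanSpace_fin, smul_eq_mul]
      have : y ^ n = y ^ (n - 1) * y := by
        rw [← pow_succ, Nat.sub_add_cancel NeZero.one_le]
      rw [this]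
      field_simp
    · simp [indicator_of_notMem hyI]
  have hci : IntegrableOn (fun y : ℝ => y⁻¹) (Icc a b) :=
    (continuousOn_inv₀.mono fun y hy => (ha.trans_le hy.1).ne').integrableOn_compact isCompact_Icc
  constructor
  · have : Nontrivial E := by
      have : Nonempty (Fin n) := ⟨⊤⟩
      infer_instance
    rw [integrable_fun_norm_addHaar volume (f := (Icc a b).indicator fun r => (r ^ n)⁻¹),
      integrableOn_congr_fun e measurableSet_Ioi]
    exact ((integrable_indicator_iff measurableSet_Icc).2 hci).integrableOn
  · have : Nontrivial E := by
      have : Nonempty (Fin n) := ⟨⊤⟩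
      infer_instance
    rw [integral_fun_norm_addHaar volume ((Icc a b).indicator fun r => (r ^ n)⁻¹),
      setIntegral_congr_fun measurableSet_Ioi e, setIntegral_indicator measurableSet_Icc,
      inter_eq_right.2 hsub, integral_Icc_eq_integral_Ioc,
      ← intervalIntegral.integral_of_le hab, integral_inv_of_pos ha (ha.trans_le hab)]
    simp [mul_assoc]

/-- With a = e^(-t/2), the term a^4 is the regularization ε of the logarithm, and the inequality
says that it does not disturb the inner edge of the annulus. -/
theorem sq_add_pow_four_lt {a : ℝ} (h0 : 0 < a) (h1 : a ≤ 2 / 3) : a ^ 2 + a ^ 4 < a := by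
  have h2 : a ^ 2 ≤ 2 / 3 * a := by nlinarith
  have h4 : a ^ 4 ≤ 2 / 3 * a * (2 / 3 * (2 / 3)) := by
    calc a ^ 4 = a ^ 2 * (a * a) := by ring
      _ ≤ _ := by gcongr
  linarith

theorem exp_neg_half_le {t : ℝ} (ht : 1 ≤ t) : Real.exp (-(t / 2)) ≤ 2 / 3 := by
  rw [Real.exp_neg, inv_le_comm₀ (Real.exp_pos _) (by norm_num)]
  linarith [Real.add_one_le_exp (t / 2)]

set_option maxHeartbeats 800000 in
/-- At distances at least one, a truncation of the logarithm of the norm is almost extremal. -/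
theorem exists_log_profile (p : ℝ) (hp : (n : ℝ) < p) :
    ∃ B : ℝ, 0 < B ∧ ∀ t : ℝ, 1 ≤ t → ∃ (u : E → ℝ) (Du : E → E →L[ℝ] ℝ),
      HasSobolevDeriv p u Du ∧ hypNorm p Du ≤ B * t ^ (1 / p) ∧
      ∀ᶠ z in 𝓝 (vertical n (t / 2), vertical n (-(t / 2))), t ≤ |u z.1 - u z.2| := by
  have hp0 : 0 < p := (Nat.cast_nonneg n).trans_lt hp
  obtain ⟨K, hK0, hK, hKz⟩ := exists_smoothTransition_deriv_bound
  set κ : ℝ := (volume : Measure E).real (ball 0 1) with hκ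
  have hκ0 : 0 < κ := ENNReal.toReal_pos (measure_ball_pos _ _ one_pos).ne' measure_ball_lt_top.ne
  have hn0 : (0 : ℝ) < n := by exact_mod_cast NeZero.pos n
  refine ⟨((2 * K) ^ p * (n * κ)) ^ (1 / p), by positivity, fun t ht => ?_⟩
  have ht0 : 0 < t := by linarith
  -- The term ε makes the logarithm smooth at the origin. At the two test points `w` is close to 3/2
  -- and -1/2, so the transition lies strictly between them and `u` is exactly t and 0 nearby.
  set ε := Real.exp (-(2 * t)) with hε
  have hε0 : 0 < ε := Real.exp_pos _
  set w : E → ℝ := fun z => Real.log (‖z‖ ^ 2 + ε) / t + 1 / 2 with hw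
  set u : E → ℝ := fun z => t * Real.smoothTransition (w z) with hu
  have hpos : ∀ z : E, 0 < ‖z‖ ^ 2 + ε := fun z => by positivity
  have hws : ContDiff ℝ ∞ w := by
    have h1 : ContDiff ℝ ∞ fun z : E => ‖z‖ ^ 2 + ε := (contDiff_norm_sq ℝ).add contDiff_const
    exact ((h1.log fun z => (hpos z).ne').div_const t).add contDiff_const
  have hus : ContDiff ℝ ∞ u := contDiff_const.mul (Real.smoothTransition.contDiff.comp hws)
  have hwd : ∀ z, HasFDerivAt w (t⁻¹ • ((‖z‖ ^ 2 + ε)⁻¹ • ((2 : ℝ) • innerSL ℝ z))) z := fun z => by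
    have h1 : HasFDerivAt (fun z : E => ‖z‖ ^ 2 + ε) ((2 : ℝ) • innerSL ℝ z) z :=
      ((hasStrictFDerivAt_norm_sq z).hasFDerivAt.add_const ε).congr_fderiv (by
        ext v
        simp [two_mul])
    have h2 := ((h1.log (hpos z).ne').const_mul t⁻¹).add_const (1 / 2)
    refine h2.congr_of_eventuallyEq (Eventually.of_forall fun y => ?_)
    simp only [hw]
    ring
  have hud : ∀ z, fderiv ℝ u z = t • (deriv Real.smoothTransition (w z) •
      (t⁻¹ • ((‖z‖ ^ 2 + ε)⁻¹ • ((2 : ℝ) • innerSL ℝ z)))) := fun z => by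
    have hd : HasDerivAt Real.smoothTransition (deriv Real.smoothTransition (w z)) (w z) :=
      ((Real.smoothTransition.contDiff (n := 1)).differentiable (by simp) _).hasDerivAt
    exact ((hd.comp_hasFDerivAt z (hwd z)).const_mul t).fderiv
  set a := Real.exp (-(t / 2)) with ha
  set b := Real.exp (t / 2) with hb
  have hrange : ∀ z, w z ∈ Icc (0 : ℝ) 1 → ‖z‖ ∈ Icc a b := by
    intro z hz
    have h1 : -(t / 2) ≤ Real.log (‖z‖ ^ 2 + ε) := by
      have := hz.1
      simp only [hw] at this
      have h2 : -(1 / 2) ≤ Real.log (‖z‖ ^ 2 + ε) / t := by linarith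
      rw [le_div_iff₀ ht0] at h2
      linarith
    have h2 : Real.log (‖z‖ ^ 2 + ε) ≤ t / 2 := by
      have := hz.2
      simp only [hw] at this
      have h2 : Real.log (‖z‖ ^ 2 + ε) / t ≤ 1 / 2 := by linarith
      rw [div_le_iff₀ ht0] at h2
      linarith
    rw [Real.le_log_iff_exp_le (hpos z)] at h1
    rw [Real.log_le_iff_le_exp (hpos z)] at h2
    have hε' : ε = a ^ 4 := by
      rw [hε, ha, ← Real.exp_nat_mul]; push_cast; ring_nf
    have hb1 : 1 ≤ b := Real.one_le_exp (by linarith)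
    have ha0 : 0 < a := Real.exp_pos _
    have hn := norm_nonneg z
    constructor
    · have h5 : a ^ 2 ≤ ‖z‖ ^ 2 := by linarith [sq_add_pow_four_lt ha0 (exp_neg_half_le ht)]
      exact (sq_le_sq₀ ha0.le hn).1 h5
    · have h5 : ‖z‖ ^ 2 ≤ b ^ 2 := by nlinarith
      exact (sq_le_sq₀ hn (by linarith)).1 h5
  have hab : a ≤ b := Real.exp_le_exp.2 (by linarith)
  have ha0 : 0 < a := Real.exp_pos _
  obtain ⟨hi, hint⟩ := integral_indicator_norm_rpow n ha0 hab
  have hg0 : ∀ z : E, 0 ≤ (2 * K) ^ p * (Icc a b).indicator (fun r => (r ^ n)⁻¹) ‖z‖ := fun z =>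
    mul_nonneg (by positivity) (indicator_nonneg (fun r hr => by
      have : 0 < r := ha0.trans_le hr.1
      positivity) _)
  obtain ⟨h1, h2⟩ := hasSobolevDeriv_of_contDiff
    (g := fun z : E => (2 * K) ^ p * (Icc a b).indicator (fun r => (r ^ n)⁻¹) ‖z‖) hp0 hus
    (hi.const_mul _) hg0 (fun z hz => by
      have hz0 : 0 < z ⊤ := hz
      by_cases hwz : w z ∈ Icc (0 : ℝ) 1
      · have hzn := hrange z hwz
        have hzn0 : 0 < ‖z‖ := ha0.trans_le hzn.1
        rw [indicator_of_mem hzn]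
        have hzle : z ⊤ ≤ ‖z‖ := (le_abs_self _).trans (PiLp.norm_apply_le z ⊤)
        have hn : ‖fderiv ℝ u z‖ ≤ 2 * K / ‖z‖ := by
          rw [hud, norm_smul, norm_smul, norm_smul, norm_smul, norm_smul, innerSL_apply_norm,
            Real.norm_of_nonneg ht0.le, Real.norm_of_nonneg (inv_nonneg.2 ht0.le),
            Real.norm_of_nonneg (inv_nonneg.2 (hpos z).le), Real.norm_eq_abs, Real.norm_two]
          have e : (‖z‖ ^ 2 + ε)⁻¹ * (2 * ‖z‖) ≤ 2 / ‖z‖ := by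
            rw [inv_mul_eq_div, div_le_div_iff₀ (hpos z) hzn0]
            nlinarith
          calc t * (|deriv Real.smoothTransition (w z)| *
                (t⁻¹ * ((‖z‖ ^ 2 + ε)⁻¹ * (2 * ‖z‖))))
              = |deriv Real.smoothTransition (w z)| * ((‖z‖ ^ 2 + ε)⁻¹ * (2 * ‖z‖)) := by
                field_simp
            _ ≤ K * (2 / ‖z‖) := by
                gcongr
                exact hK _
            _ = _ := by ring
        have hpn : 0 ≤ p - n := by linarith
        -- Since zₙ ≤ ‖z‖ and p > n, the weight is dominated by a radial one, leaving (2K)^p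
        -- ‖z‖^(-n).
        calc z ⊤ ^ (p - n) * ‖fderiv ℝ u z‖ ^ p ≤ ‖z‖ ^ (p - n) * (2 * K / ‖z‖) ^ p := by gcongr
          _ = _ := by
            rw [Real.div_rpow (by positivity) hzn0.le, Real.rpow_sub hzn0, Real.rpow_natCast]
            field_simp
      · rw [hud, hKz _ hwz, zero_smul, smul_zero, norm_zero, Real.zero_rpow hp0.ne', mul_zero]
        exact hg0 z)
  refine ⟨u, _, h1, h2.trans (le_of_eq ?_), ?_⟩
  · rw [integral_const_mul, hint, hb, ha, ← Real.exp_sub, Real.log_exp, ← Real.mul_rpow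
      (by positivity) ht0.le]
    congr 1
    ring
  · have hwc : Continuous w := hws.continuous
    have hx : 1 < w (vertical n (t / 2)) := by
      simp only [hw, norm_vertical]
      have : t < Real.log (Real.exp (t / 2) ^ 2 + ε) := by
        rw [Real.lt_log_iff_exp_lt (by positivity), ← Real.exp_nat_mul]
        push_cast
        rw [mul_div_cancel₀ _ (by norm_num : (2 : ℝ) ≠ 0)]
        linarith
      have : 1 < Real.log (Real.exp (t / 2) ^ 2 + ε) / t := by rwa [one_lt_div ht0]
      linarith
    have hy : w (vertical n (-(t / 2))) < 0 := by
      simp only [hw, norm_vertical]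
      have : Real.log (Real.exp (-(t / 2)) ^ 2 + ε) < -(t / 2) := by
        rw [Real.log_lt_iff_lt_exp (by positivity)]
        have hε' : ε = a ^ 4 := by
          rw [hε, ha, ← Real.exp_nat_mul]; push_cast; ring_nf
        rw [hε', ← ha]
        exact sq_add_pow_four_lt ha0 (exp_neg_half_le ht)
      have : Real.log (Real.exp (-(t / 2)) ^ 2 + ε) / t < -(1 / 2) := by
        rw [div_lt_iff₀ ht0]
        linarith
      linarith
    have e1 : ∀ᶠ z : E × E in 𝓝 (vertical n (t / 2), vertical n (-(t / 2))), 1 < w z.1 :=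
      (isOpen_lt continuous_const (hwc.comp continuous_fst)).mem_nhds hx
    have e2 : ∀ᶠ z : E × E in 𝓝 (vertical n (t / 2), vertical n (-(t / 2))), w z.2 < 0 :=
      (isOpen_lt (hwc.comp continuous_snd) continuous_const).mem_nhds hy
    filter_upwards [e1, e2] with z hz1 hz2
    simp only [hu]
    rw [Real.smoothTransition.one_of_one_le hz1.le, Real.smoothTransition.zero_of_nonpos hz2.le]
    simp [abs_of_pos ht0]

/-! ### From almost every pair of points to almost every distance. -/

/-- Almost every line in a given direction meets a null set in a null set. -/
theorem ae_ae_line {F : Type*} [NormedAddCommGroup F] [NormedSpace ℝ F]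
    [MeasurableSpace F] [BorelSpace F] [SecondCountableTopology F]
    (μ : Measure F) [μ.IsAddLeftInvariant] [SFinite μ] (v : F) {P : F → Prop}
    (h : ∀ᵐ z ∂μ, P z) : ∀ᵐ z ∂μ, ∀ᵐ s : ℝ, P (z + s • v) := by
  -- `P` need not be measurable, so its exceptional set is enlarged to a measurable null set before
  -- exchanging the quantifiers; for fixed s, translation preserves μ.
  set T := toMeasurable μ {z | ¬P z} with hT
  have hTm : MeasurableSet T := measurableSet_toMeasurable _ _
  have hT0 : μ T = 0 := by rw [hT, measure_toMeasurable]; exact h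
  have hTP : ∀ z, z ∉ T → P z := fun z hz => by
    by_contra hn
    exact hz (subset_toMeasurable _ _ hn)
  have key : ∀ᵐ z ∂μ, ∀ᵐ s : ℝ, z + s • v ∉ T := by
    rw [Measure.ae_ae_comm (p := fun z (s : ℝ) => z + s • v ∉ T)
      ((by fun_prop : Measurable fun q : F × ℝ => q.1 + q.2 • v) hTm.compl)]
    refine Eventually.of_forall fun s => ?_
    exact (measurePreserving_add_right μ (s • v)).quasiMeasurePreserving.ae
      (p := fun z => z ∉ T) (measure_eq_zero_iff_ae_notMem.1 hT0)
  exact key.mono fun z hz => hz.mono fun s hs => hTP _ hs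

variable (n) in
theorem absolutelyContinuous_hypVolume : volume.restrict (halfSpace n) ≪ hypVolume n := by
  refine withDensity_absolutelyContinuous' (by fun_prop) ?_
  filter_upwards [ae_restrict_mem (measurableSet_halfSpace n)] with z hz
  have hz0 : 0 < z ⊤ := hz
  rw [Ne, ENNReal.ofReal_eq_zero, not_le]
  positivity

theorem ae_volume_of_ae_hypVolume_prod {P : E × E → Prop}
    (h : ∀ᵐ z ∂(hypVolume n).prod (hypVolume n), P z) :
    ∀ᵐ z : E × E, 0 < z.1 ⊤ → 0 < z.2 ⊤ → P z := by
  have : SFinite (hypVolume n) := by unfold hypVolume; infer_instance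
  have h1 := ((absolutelyContinuous_hypVolume n).prod (absolutelyContinuous_hypVolume n)).ae_le h
  rw [Measure.prod_restrict, ← Measure.volume_eq_prod] at h1
  have h2 := (ae_restrict_iff' ((measurableSet_halfSpace n).prod (measurableSet_halfSpace n))).1 h1
  filter_upwards [h2] with z hz a b using hz ⟨a, b⟩

theorem continuousAt_hypDist {z : E × E} (h1 : 0 < z.1 ⊤) (h2 : 0 < z.2 ⊤) :
    ContinuousAt (fun z : E × E => hypDist z.1 z.2) z := by
  unfold hypDist
  have : 2 * √(z.1 ⊤ * z.2 ⊤) ≠ 0 := by positivity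
  have h3 : ContinuousAt (fun z : E × E => dist z.1 z.2 / (2 * √(z.1 ⊤ * z.2 ⊤))) z := by
    apply ContinuousAt.div <;> first | fun_prop | assumption
  exact (Real.continuous_arsinh.continuousAt.comp h3).const_mul 2

theorem differentiableAt_hypDist {x y v : E} {s : ℝ} (h1 : 0 < (x + s • v) ⊤) (h2 : 0 < y ⊤)
    (h3 : x + s • v ≠ y) : DifferentiableAt ℝ (fun s : ℝ => hypDist (x + s • v) y) s := by
  unfold hypDist
  have hl : DifferentiableAt ℝ (fun s : ℝ => x + s • v) s := by fun_prop
  have hd : DifferentiableAt ℝ (fun s : ℝ => dist (x + s • v) y) s :=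
    hl.dist ℝ (differentiableAt_const y) h3
  have hc : DifferentiableAt ℝ (fun s : ℝ => (x + s • v) ⊤ * y ⊤) s := by
    simp only [PiLp.add_apply, PiLp.smul_apply]
    fun_prop
  have hs := hc.sqrt (by positivity)
  have hq := hd.div (hs.const_mul 2) (by positivity)
  exact ((Real.differentiable_arsinh _).comp s hq).const_mul 2

theorem vertical_add (a s : ℝ) (h : 0 < Real.exp a + s) :
    vertical n a + s • EuclideanSpace.single ⊤ 1 = vertical n (Real.log (Real.exp a + s)) := by
  rw [vertical, vertical, Real.exp_log h, add_smul]

/-- A property of the hyperbolic distance that holds for almost all pairs of points near a vertical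
pair holds for almost all nearby real numbers. -/
theorem exists_nhds_ae_of_ae_hypDist {P : ℝ → Prop} {Q : E × E → Prop} {t : ℝ} (ht : 0 < t)
    (hQ : ∀ᶠ z in 𝓝 (vertical n (t / 2), vertical n (-(t / 2))), Q z)
    (h : ∀ᵐ z ∂(hypVolume n).prod (hypVolume n), Q z → P (hypDist z.1 z.2)) :
    ∃ U ∈ 𝓝 t, ∀ᵐ r, r ∈ U → P r := by
  set x₀ := vertical n (t / 2) with hx₀
  set y₀ := vertical n (-(t / 2)) with hy₀
  set e : E := EuclideanSpace.single ⊤ 1 with he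
  have hpx : 0 < x₀ ⊤ := by rw [hx₀, vertical_last]; positivity
  have hpy : 0 < y₀ ⊤ := by rw [hy₀, vertical_last]; positivity
  have hne : x₀ ≠ y₀ := fun hxy => by
    have : x₀ ⊤ = y₀ ⊤ := by rw [hxy]
    rw [hx₀, hy₀, vertical_last, vertical_last, Real.exp_eq_exp] at this
    linarith
  have hW : ∀ᶠ z : E × E in 𝓝 (x₀, y₀), 0 < z.1 ⊤ ∧ 0 < z.2 ⊤ ∧ z.1 ≠ z.2 ∧ Q z := by
    refine Filter.Eventually.and ?_ (Filter.Eventually.and ?_ (Filter.Eventually.and ?_ hQ))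
    · exact (isOpen_lt continuous_const (continuous_lastCoord.comp continuous_fst)).mem_nhds hpx
    · exact (isOpen_lt continuous_const (continuous_lastCoord.comp continuous_snd)).mem_nhds hpy
    · exact (isOpen_ne_fun continuous_fst continuous_snd).mem_nhds hne
  obtain ⟨η, hη, hball⟩ := Metric.eventually_nhds_iff.1 hW
  -- Half of ε is the vertical travel: small enough to stay where `Q` holds, and to keep the moving
  -- point above the fixed one.
  set ε := min η (Real.exp (t / 2) - Real.exp (-(t / 2))) with hε
  have hε0 : 0 < ε := lt_min hη (sub_pos.2 (Real.exp_lt_exp.2 (by linarith)))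
  set δ := ε / 2 with hδ
  have hδ0 : 0 < δ := by positivity
  have hδη : 2 * δ ≤ η := by rw [hδ]; linarith [min_le_left η (Real.exp (t / 2) - Real.exp (-(t / 2)))]
  have hlow : Real.exp (-(t / 2)) < Real.exp (t / 2) - δ := by
    linarith [min_le_right η (Real.exp (t / 2) - Real.exp (-(t / 2)))]
  have hdist : ∀ s : ℝ, Real.exp (-(t / 2)) < Real.exp (t / 2) + s →
      hypDist (x₀ + s • e) y₀ = Real.log (Real.exp (t / 2) + s) + t / 2 := by
    intro s hs
    have hpos : 0 < Real.exp (t / 2) + s := (Real.exp_pos _).trans hs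
    rw [hx₀, he, vertical_add _ _ hpos, hy₀, hypDist_vertical]
    · ring
    · rw [Real.le_log_iff_exp_le hpos]; exact hs.le
  -- The distances at the two ends of the travel strictly bracket t, an open condition that persists
  -- for nearby pairs.
  have hminus : hypDist (x₀ + (-δ) • e) y₀ < t := by
    rw [hdist _ (by linarith)]
    have : Real.log (Real.exp (t / 2) + -δ) < t / 2 := by
      rw [Real.log_lt_iff_lt_exp (by linarith [Real.exp_pos (-(t / 2))])]
      linarith
    linarith
  have hplus : t < hypDist (x₀ + δ • e) y₀ := by
    rw [hdist _ (by linarith)]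
    have : t / 2 < Real.log (Real.exp (t / 2) + δ) := by
      rw [Real.lt_log_iff_exp_lt (by linarith [Real.exp_pos (-(t / 2))])]
      linarith
    linarith
  have hcoord : ∀ s : ℝ, -δ ≤ s → 0 < (x₀ + s • e) ⊤ := fun s hs => by
    rw [hx₀, he, PiLp.add_apply, PiLp.smul_apply, vertical_last]
    simp only [PiLp.single_apply, if_true, smul_eq_mul, mul_one]
    linarith [Real.exp_pos (-(t / 2))]
  have hcont : ∀ s : ℝ, -δ ≤ s →
      ContinuousAt (fun z : E × E => hypDist (z.1 + s • e) z.2) (x₀, y₀) := fun s hs =>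
    ContinuousAt.comp (g := fun z : E × E => hypDist z.1 z.2)
      (f := fun z : E × E => (z.1 + s • e, z.2))
      (continuousAt_hypDist (z := (x₀ + s • e, y₀)) (hcoord s hs) hpy) (by fun_prop)
  have n1 := (hcont (-δ) le_rfl).eventually (gt_mem_nhds hminus)
  have n2 := (hcont δ (by linarith)).eventually (lt_mem_nhds hplus)
  have n3 : ∀ᶠ z : E × E in 𝓝 (x₀, y₀), dist z (x₀, y₀) < δ := ball_mem_nhds _ hδ0
  have : (volume : Measure (E × E)).IsAddHaarMeasure := by
    rw [Measure.volume_eq_prod]; infer_instance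
  have hline := ae_ae_line (volume : Measure (E × E)) (e, 0) (ae_volume_of_ae_hypVolume_prod h)
  -- The vertical line through (x₀, y₀) itself may be exceptional; pairs with a good line are dense,
  -- so one is taken nearby.
  obtain ⟨z, hz4, ⟨hz1, hz2⟩, hz3⟩ := (Measure.dense_of_ae hline).inter_nhds_nonempty
    (inter_mem (inter_mem n1 n2) n3)
  have hz1' : hypDist (z.1 + (-δ) • e) z.2 < t := hz1
  have hz2' : t < hypDist (z.1 + δ • e) z.2 := hz2
  have hgood : ∀ s ∈ Icc (-δ) δ, 0 < (z.1 + s • e) ⊤ ∧ 0 < z.2 ⊤ ∧ z.1 + s • e ≠ z.2 ∧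
      Q (z.1 + s • e, z.2) := by
    intro s hs
    refine hball (y := (z.1 + s • e, z.2)) ?_
    have hz3' : dist z (x₀, y₀) < δ := hz3
    have hm : dist (z.1 + s • e, z.2) z ≤ δ := by
      rw [Prod.dist_eq, dist_self, dist_self_add_left, he, norm_smul]
      simp only [PiLp.norm_single, norm_one, mul_one, Real.norm_eq_abs]
      exact max_le (abs_le.2 hs) hδ0.le
    calc dist (z.1 + s • e, z.2) (x₀, y₀) ≤ dist (z.1 + s • e, z.2) z + dist z (x₀, y₀) :=
          dist_triangle _ _ _
      _ < 2 * δ := by linarith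
      _ ≤ η := hδη
  set γ : ℝ → ℝ := fun s => hypDist (z.1 + s • e) z.2 with hγ
  have hγd : DifferentiableOn ℝ γ (Icc (-δ) δ) := fun s hs =>
    (differentiableAt_hypDist (hgood s hs).1 (hgood s hs).2.1
      (hgood s hs).2.2.1).differentiableWithinAt
  refine ⟨Ioo (γ (-δ)) (γ δ), Ioo_mem_nhds hz1' hz2', ?_⟩
  have hnull : volume {s : ℝ | s ∈ Icc (-δ) δ ∧ ¬P (γ s)} = 0 := by
    have hz4' : ∀ᵐ s : ℝ, 0 < (z + s • (e, (0 : E))).1 ⊤ → 0 < (z + s • (e, (0 : E))).2 ⊤ →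
      Q (z + s • (e, 0)) → P (hypDist (z + s • (e, (0 : E))).1 (z + s • (e, (0 : E))).2) := hz4
    have hae : ∀ᵐ s : ℝ, s ∈ Icc (-δ) δ → P (γ s) := by
      filter_upwards [hz4'] with s hs' hs
      have ez : z + s • (e, (0 : E)) = (z.1 + s • e, z.2) := by ext <;> simp
      rw [ez] at hs'
      exact hs' (hgood s hs).1 (hgood s hs).2.1 (hgood s hs).2.2.2
    refine measure_mono_null ?_ hae
    rintro s ⟨hs, hP⟩ hs'
    exact hP (hs' hs)
  -- A differentiable map sends null sets to null sets, and by the intermediate value theorem the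
  -- distances along the line fill a neighbourhood of t.
  have himg := addHaar_image_eq_zero_of_differentiableOn_of_addHaar_eq_zero volume
    (hγd.mono fun s hs => hs.1) hnull
  refine measure_mono_null ?_ himg
  intro r hr
  have hr' : r ∈ Ioo (γ (-δ)) (γ δ) ∧ ¬P r := Classical.not_imp.1 hr
  obtain ⟨s, hs, rfl⟩ := intermediate_value_Icc (by linarith) hγd.continuousOn
    (Ioo_subset_Icc_self hr'.1)
  exact ⟨s, ⟨hs, hr'.2⟩, rfl⟩

/-! ### The lower bound and the conclusion. -/

/-- Test functions that almost saturate the estimate at every distance. -/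
theorem exists_test_function (p : ℝ) (hp : (n : ℝ) < p) :
    ∃ c : ℝ, 0 < c ∧ ∀ t : ℝ, 0 < t → ∃ (u : E → ℝ) (Du : E → E →L[ℝ] ℝ) (A N : ℝ),
      HasSobolevDeriv p u Du ∧ 0 < N ∧ hypNorm p Du ≤ N ∧
      c * max (t ^ (1 - n / p)) (t ^ (1 - 1 / p)) * N < A ∧
      ∀ᶠ z in 𝓝 (vertical n (t / 2), vertical n (-(t / 2))), A ≤ |u z.1 - u z.2| := by
  obtain ⟨B₁, hB₁, h₁⟩ := exists_bump (n := n) p hp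
  obtain ⟨B₂, hB₂, h₂⟩ := exists_log_profile (n := n) p hp
  have hn1 : (1 : ℝ) ≤ n := by exact_mod_cast NeZero.one_le
  have hp0 : 0 < p := by linarith
  have hexp : 1 - (n : ℝ) / p ≤ 1 - 1 / p := by gcongr
  have hc1 : 1 / (2 * (B₁ + B₂)) * B₁ < 1 := by
    rw [div_mul_eq_mul_div, div_lt_one (by positivity)]; linarith
  have hc2 : 1 / (2 * (B₁ + B₂)) * B₂ < 1 := by
    rw [div_mul_eq_mul_div, div_lt_one (by positivity)]; linarith
  -- The factor 2 is more than needed for the strict inequality, which is what persists at distances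
  -- near t.
  refine ⟨1 / (2 * (B₁ + B₂)), by positivity, fun t ht => ?_⟩
  rcases le_total t 1 with ht1 | ht1
  · obtain ⟨u, Du, hu, hN, hev⟩ := h₁ t ht ht1
    refine ⟨u, Du, 1, _, hu, by positivity, hN, ?_, hev⟩
    rw [max_eq_left (Real.rpow_le_rpow_of_exponent_ge ht ht1 hexp), Real.rpow_neg ht.le]
    have : t ^ (1 - (n : ℝ) / p) ≠ 0 := by positivity
    calc 1 / (2 * (B₁ + B₂)) * t ^ (1 - (n : ℝ) / p) * (B₁ * (t ^ (1 - (n : ℝ) / p))⁻¹)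
        = 1 / (2 * (B₁ + B₂)) * B₁ := by field_simp
      _ < 1 := hc1
  · obtain ⟨u, Du, hu, hN, hev⟩ := h₂ t ht1
    refine ⟨u, Du, t, _, hu, by positivity, hN, ?_, hev⟩
    rw [max_eq_right (Real.rpow_le_rpow_of_exponent_le ht1 hexp)]
    have e : t ^ (1 - 1 / p) * t ^ (1 / p) = t := by
      rw [← Real.rpow_add ht, sub_add_cancel, Real.rpow_one]
    calc 1 / (2 * (B₁ + B₂)) * t ^ (1 - 1 / p) * (B₂ * t ^ (1 / p))
        = 1 / (2 * (B₁ + B₂)) * B₂ * (t ^ (1 - 1 / p) * t ^ (1 / p)) := by ring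
      _ = 1 / (2 * (B₁ + B₂)) * B₂ * t := by rw [e]
      _ < t := by nlinarith

/-- One test function, built for t, serves a whole neighbourhood of t: A ≤ θ N holds almost
everywhere there, and c max(...) N < A by continuity. A locally null set is null. -/
theorem exists_modulus_lower_bound (p : ℝ) (hp : (n : ℝ) < p) :
    ∃ c : ℝ, 0 < c ∧ ∀ θ : ℝ → ℝ, (∀ t, 0 ≤ t → 0 ≤ θ t) →
      (∀ (u : E → ℝ) (Du : E → E →L[ℝ] ℝ), HasSobolevDeriv p u Du →
        ∀ᵐ z ∂(hypVolume n).prod (hypVolume n),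
          |u z.1 - u z.2| ≤ θ (hypDist z.1 z.2) * hypNorm p Du) →
      ∀ᵐ t, 0 < t → c * max (t ^ (1 - n / p)) (t ^ (1 - 1 / p)) ≤ θ t := by
  obtain ⟨c, hc, h⟩ := exists_test_function (n := n) p hp
  refine ⟨c, hc, fun θ hθ0 hθ => ?_⟩
  refine measure_null_of_locally_null _ fun t ht => ?_
  have ht0 : 0 < t := (Classical.not_imp.1 ht).1
  obtain ⟨u, Du, A, N, hu, hN, hNle, hA, hev⟩ := h t ht0
  have hae : ∀ᵐ z ∂(hypVolume n).prod (hypVolume n), A ≤ |u z.1 - u z.2| →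
      A ≤ θ (hypDist z.1 z.2) * N := by
    filter_upwards [hθ u Du hu] with z hz hAz
    exact (hAz.trans hz).trans
      (mul_le_mul_of_nonneg_left hNle (hθ0 _ (hypDist_nonneg _ _)))
  obtain ⟨U, hU, hUae⟩ := exists_nhds_ae_of_ae_hypDist (P := fun r => A ≤ θ r * N) ht0 hev hae
  have hcont : ContinuousAt
      (fun r : ℝ => c * max (r ^ (1 - (n : ℝ) / p)) (r ^ (1 - 1 / p)) * N) t :=
    (continuousAt_const.mul ((Real.continuousAt_rpow_const _ _ (Or.inl ht0.ne')).max
      (Real.continuousAt_rpow_const _ _ (Or.inl ht0.ne')))).mul continuousAt_const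
  have hV := hcont.eventually (gt_mem_nhds hA)
  refine ⟨_, inter_mem_nhdsWithin _ (inter_mem hU hV), measure_mono_null ?_ hUae⟩
  rintro r ⟨hr, hrU, hrV⟩ hr'
  refine hr fun _ => ?_
  have h1 : c * max (r ^ (1 - (n : ℝ) / p)) (r ^ (1 - 1 / p)) * N < A := hrV
  have h2 : A ≤ θ r * N := hr' hrU
  exact (lt_of_mul_lt_mul_right (h1.trans_le h2) hN.le).le

end HalfSpaceModel

theorem theorem1p6 (n : ℕ) [NeZero n] (p : ℝ) (hp : (n : ℝ) < p) :
    (∃ C : ℝ, 0 < C ∧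
      ∀ (u : EuclideanSpace ℝ (Fin n) → ℝ)
        (Du : EuclideanSpace ℝ (Fin n) → EuclideanSpace ℝ (Fin n) →L[ℝ] ℝ),
        HasSobolevDeriv p u Du →
        ∀ᵐ z ∂(hypVolume n).prod (hypVolume n),
          |u z.1 - u z.2| ≤
            C * max (hypDist z.1 z.2 ^ (1 - n / p)) (hypDist z.1 z.2 ^ (1 - 1 / p)) *
              hypNorm p Du) ∧
    (∃ c : ℝ, 0 < c ∧
      ∀ θ : ℝ → ℝ, (∀ t, 0 ≤ t → 0 ≤ θ t) →
        (∀ (u : EuclideanSpace ℝ (Fin n) → ℝ)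
          (Du : EuclideanSpace ℝ (Fin n) → EuclideanSpace ℝ (Fin n) →L[ℝ] ℝ),
          HasSobolevDeriv p u Du →
          ∀ᵐ z ∂(hypVolume n).prod (hypVolume n),
            |u z.1 - u z.2| ≤ θ (hypDist z.1 z.2) * hypNorm p Du) →
        (∀ᵐ t ∂volume.restrict (Ici (0 : ℝ)),
          c * max (t ^ (1 - n / p)) (t ^ (1 - 1 / p)) ≤ θ t) ∧
        (ContinuousOn θ (Ici 0) →
          ∀ t, 0 ≤ t → c * max (t ^ (1 - n / p)) (t ^ (1 - 1 / p)) ≤ θ t)) := by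
  refine ⟨exists_sobolev_morrey_bound p hp, ?_⟩
  obtain ⟨c, hc, h⟩ := exists_modulus_lower_bound (n := n) p hp
  refine ⟨c, hc, fun θ hθ0 hθ => ?_⟩
  have hn1 : (1 : ℝ) ≤ n := by exact_mod_cast NeZero.one_le
  have hp0 : 0 < p := by linarith
  have hα : 1 - (n : ℝ) / p ≠ 0 := by
    have : (n : ℝ) / p < 1 := (div_lt_one hp0).2 hp
    linarith
  have hβ : 1 - 1 / p ≠ 0 := by
    have : 1 / p < 1 := (div_lt_one hp0).2 (by linarith)
    linarith
  -- At distance 0 both powers vanish because their exponents are nonzero.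
  have hzero : c * max ((0 : ℝ) ^ (1 - (n : ℝ) / p)) ((0 : ℝ) ^ (1 - 1 / p)) ≤ θ 0 := by
    rw [Real.zero_rpow hα, Real.zero_rpow hβ, max_self, mul_zero]
    exact hθ0 0 le_rfl
  have hae := h θ hθ0 hθ
  constructor
  · rw [ae_restrict_iff' measurableSet_Ici]
    filter_upwards [hae] with t ht ht0
    rcases eq_or_lt_of_le (mem_Ici.1 ht0) with rfl | ht0
    · exact hzero
    · exact ht ht0
  · intro hcont t ht
    rcases eq_or_lt_of_le ht with rfl | ht0
    · exact hzero
    set m : ℝ → ℝ := fun t => c * max (t ^ (1 - (n : ℝ) / p)) (t ^ (1 - 1 / p)) with hm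
    have hmc : ContinuousOn m (Ioi 0) := fun r hr =>
      (continuousAt_const.mul ((Real.continuousAt_rpow_const _ _ (Or.inl (ne_of_gt hr))).max
        (Real.continuousAt_rpow_const _ _ (Or.inl (ne_of_gt hr))))).continuousWithinAt
    have hθc : ContinuousOn θ (Ioi 0) := hcont.mono Ioi_subset_Ici_self
    -- Two functions continuous on an open set and equal almost everywhere there agree on it, so the
    -- inequality is encoded as max(m, θ) = θ.
    have heq : EqOn (fun r => max (m r) (θ r)) θ (Ioi 0) := by
      refine Measure.eqOn_open_of_ae_eq (μ := volume) ?_ isOpen_Ioi (ContinuousOn.sup hmc hθc) hθc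
      rw [Filter.EventuallyEq, ae_restrict_iff' measurableSet_Ioi]
      filter_upwards [hae] with r hr hr0 using max_eq_right (hr hr0)
    exact max_eq_right_iff.1 (heq ht0)
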